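/- Consider a two-armed Gaussian bandit with horizon $n\ge 1$: in each round $t=1,\dots,n$ a strategy chooses an arm $I_t\in\{1,2\}$ as a (measurable, possibly randomised) function of the past choices and rewards, and receives a reward $X_t\sim\mathcal N(\mu_{I_t},1)$, where $\mu=(\mu_1,\mu_2)$ is the unknown vector of means. Put $\mu^*=\max\{\mu_1,\mu_2\}$. Let $\nu_1,\nu_2\in\mathbb R$ and $\sigma_1^2,\sigma_2^2\ge 0$, and let $Q=\mathcal N(\nu_1,\sigma_1^2)\otimes\mathcal N(\nu_2,\sigma_2^2)$ be the Gaussian prior on $\mathbb R^2$ with mean $\nu$ and covariance matrix $\operatorname{diag}(\sigma_1^2,\sigma_2^2)$. A strategy is called Bayes optimal if it minimises the Bayesian regret $$\mathbb E_{\theta\sim Q}\left[\mathbb E\left[\sum_{t=1}^n(\mu^*-\mu_{I_t})\,\middle|\,\mu=\theta\right]\right]$$ among all strategies. For $\nu\in\mathbb R$, $\sigma^2\ge 0$ and $m\ge 1$ let $\mu\sim\mathcal N(\nu,\sigma^2)$ be a real random variable and, conditionally on it, let $Y_1,\dots,Y_m$ be independent with law $\mathcal N(\mu,1)$. The finite-horizon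 Gittins index is $$\gamma(\nu,\sigma^2,m)=\max\left\{\gamma\in\mathbb R:\ \sup_{1\le\tau\le m}\mathbb E[(\mu-\gamma)\tau]\ge 0\right\},$$ where the supremum is over the stopping times $\tau$, $1\le\tau\le m$, of the filtration generated by $Y_1,\dots,Y_m$. Theorem. There is a universal constant $c>0$ such that for all $n\ge1$, $\nu_1,\nu_2\in\mathbb R$ and $\sigma_1^2,\sigma_2^2\ge0$: if some Bayes-optimal strategy chooses arm $1$ in the first round (with positive probability, if it is randomised), then $$\nu_1+\sqrt{2c\,\sigma_1^2\log n}\ \ge\ \gamma(\nu_2,\sigma_2^2,n).$$ -/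

import Mathlib

open MeasureTheory ProbabilityTheory
open scoped NNReal

noncomputable section

namespace Bandit

/-! ### The Gaussian bandit -/

/-- The law of an i.i.d. sequence of standard Gaussian variables (the reward noise). -/
def noise : Measure (ℕ → ℝ) := Measure.infinitePi fun _ : ℕ => gaussianReal 0 1

instance : IsProbabilityMeasure noise := by unfold noise; infer_instance

/-- A (possibly randomised) strategy for the `d`-armed bandit. Rounds are counted from `0`: the arm
chosen in round `t` is a measurable function of the arms chosen and the rewards received in
rounds `0, …, t - 1`, and of a random seed in `[0, 1]`, drawn once, uniformly and independently of
everything else. A deterministic strategy is one that ignores the seed. -/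
structure Strategy (d : ℕ) where
  act : (t : ℕ) → unitInterval → (Fin t → Fin d × ℝ) → Fin d
  measurable_act : ∀ t, Measurable fun p : unitInterval × (Fin t → Fin d × ℝ) => act t p.1 p.2

namespace Strategy

variable {d : ℕ}

/-- The arms chosen and the rewards received before round `t`, when the seed is `u`, the vector of
means is `μ` and the noise is `ε`: choosing arm `i` in round `s` yields the reward `μ i + ε s`. -/
def history (π : Strategy d) (u : unitInterval) (μ : Fin d → ℝ) (ε : ℕ → ℝ) :
    (t : ℕ) → Fin t → Fin d × ℝ
  | 0 => Fin.elim0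
  | t + 1 =>
    Fin.snoc (history π u μ ε t)
      (π.act t u (history π u μ ε t), μ (π.act t u (history π u μ ε t)) + ε t)

/-- The arm chosen in round `t` (rounds counted from `0`). -/
def arm (π : Strategy d) (u : unitInterval) (μ : Fin d → ℝ) (ε : ℕ → ℝ) (t : ℕ) : Fin d :=
  π.act t u (π.history u μ ε t)

/-- The expected regret of `π` over `n` rounds when the vector of means is `μ`. -/
def regret (π : Strategy d) (n : ℕ) (μ : Fin d → ℝ) : ℝ :=
  ∫ p : unitInterval × (ℕ → ℝ),
    ∑ t ∈ Finset.range n, ((⨆ i, μ i) - μ (π.arm p.1 μ p.2 t))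
      ∂((volume : Measure unitInterval).prod noise)

/-- The Bayesian regret of `π` over `n` rounds under the prior `Q` on the vector of means. -/
def bayesRegret (π : Strategy d) (n : ℕ) (Q : Measure (Fin d → ℝ)) : ℝ :=
  ∫ θ, π.regret n θ ∂Q

/-- `π` minimises the Bayesian regret over `n` rounds among all strategies. -/
def IsBayesOptimal (π : Strategy d) (n : ℕ) (Q : Measure (Fin d → ℝ)) : Prop :=
  ∀ π' : Strategy d, π.bayesRegret n Q ≤ π'.bayesRegret n Q

/-- The probability that `π` chooses arm `i` in the first round. -/
def probFirst (π : Strategy d) (i : Fin d) : ENNReal :=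
  (volume : Measure unitInterval) {u | π.act 0 u Fin.elim0 = i}

end Strategy

/-- The Gaussian prior with mean `ν` and diagonal covariance matrix `diag v`. -/
def gaussianPrior {d : ℕ} (ν : Fin d → ℝ) (v : Fin d → ℝ≥0) : Measure (Fin d → ℝ) :=
  Measure.pi fun i => gaussianReal (ν i) (v i)

/-! ### The finite-horizon Gittins index -/

/-- The joint law of an unknown mean `μ ∼ N(ν, v)` and an independent noise sequence `ε`. -/
def armLaw (ν : ℝ) (v : ℝ≥0) : Measure (ℝ × (ℕ → ℝ)) := (gaussianReal ν v).prod noise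

instance (ν : ℝ) (v : ℝ≥0) : IsProbabilityMeasure (armLaw ν v) := by unfold armLaw; infer_instance

/-- The first `t` observations `μ + ε 0, …, μ + ε (t - 1)`, each `N(μ, 1)`-distributed given `μ`. -/
def obs (t : ℕ) (ω : ℝ × (ℕ → ℝ)) : Fin t → ℝ := fun s => ω.1 + ω.2 s

/-- Stopping times `1 ≤ τ ≤ m`: the event `τ = t` is measurable with respect to the `σ`-algebra
generated by the first `t` observations. -/
structure IsStoppingRule (m : ℕ) (τ : ℝ × (ℕ → ℝ) → ℕ) : Prop where
  one_le : ∀ ω, 1 ≤ τ ω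
  le : ∀ ω, τ ω ≤ m
  measurableSet_eq : ∀ t, MeasurableSet[MeasurableSpace.comap (obs t) inferInstance] {ω | τ ω = t}

/-- The supremum of `E[(μ - γ) τ]` over all stopping times `1 ≤ τ ≤ m`. -/
def stoppingValue (ν : ℝ) (v : ℝ≥0) (m : ℕ) (γ : ℝ) : ℝ :=
  ⨆ τ : {τ // IsStoppingRule m τ}, ∫ ω, (ω.1 - γ) * (τ.1 ω : ℝ) ∂(armLaw ν v)

/-- The Gittins index of an arm with prior mean `ν`, prior variance `v` and horizon `m`: the
greatest `γ` for which the value of the stopping problem is nonnegative. For `m ≥ 1` the supremum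
is attained, see `isGreatest_gittinsIndex`. -/
def gittinsIndex (ν : ℝ) (v : ℝ≥0) (m : ℕ) : ℝ := sSup {γ | 0 ≤ stoppingValue ν v m γ}

theorem measurable_obs (t : ℕ) : Measurable (obs t) := by
  unfold obs; fun_prop

theorem IsStoppingRule.measurable {m : ℕ} {τ : ℝ × (ℕ → ℝ) → ℕ} (h : IsStoppingRule m τ) :
    Measurable τ :=
  measurable_to_countable' fun t => (measurable_obs t).comap_le _ (h.measurableSet_eq t)

theorem isStoppingRule_one {m : ℕ} (hm : 1 ≤ m) : IsStoppingRule m fun _ => 1 where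
  one_le _ := le_rfl
  le _ := hm
  measurableSet_eq _ := MeasurableSet.const _

theorem isGreatest_aux {ι : Type*} [Nonempty ι] (a b : ι → ℝ) (A M : ℝ) (ha : ∀ i, |a i| ≤ A)
    (hb : ∀ i, 1 ≤ b i) (hM : ∀ i, b i ≤ M) :
    IsGreatest {γ | 0 ≤ ⨆ i, (a i - γ * b i)} (⨆ i, a i / b i) := by
  have hA : 0 ≤ A := (abs_nonneg _).trans (ha (Classical.arbitrary ι))
  have hM1 : 1 ≤ M := (hb (Classical.arbitrary ι)).trans (hM _)
  have bdd : BddAbove (Set.range fun i => a i / b i) := by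
    refine ⟨A, ?_⟩
    rintro _ ⟨i, rfl⟩
    have := hb i
    have h2 := (abs_le.1 (ha i)).2
    rw [div_le_iff₀ (by linarith)]
    nlinarith
  have bdd' : ∀ γ, BddAbove (Set.range fun i => a i - γ * b i) := by
    intro γ
    refine ⟨A + |γ| * M, ?_⟩
    rintro _ ⟨i, rfl⟩
    have h1 := hb i
    have h2 := (abs_le.1 (ha i)).2
    have h3 : -|γ| ≤ γ := neg_abs_le γ
    have h4 := mul_le_mul_of_nonneg_left (hM i) (abs_nonneg γ)
    have h5 : -γ * b i ≤ |γ| * b i := by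
      apply mul_le_mul_of_nonneg_right _ (by linarith); linarith
    simp only
    linarith
  constructor
  · show (0 : ℝ) ≤ ⨆ i, (a i - (⨆ i, a i / b i) * b i)
    refine le_of_forall_pos_le_add fun e he => ?_
    obtain ⟨i, hi⟩ := exists_lt_of_lt_ciSup
      (show (⨆ i, a i / b i) - e / M < ⨆ i, a i / b i by
        have : 0 < e / M := by positivity
        linarith)
    have hbi : 0 < b i := by linarith [hb i]
    rw [lt_div_iff₀ hbi] at hi
    have h1 : e / M * b i ≤ e := by
      rw [div_mul_eq_mul_div, div_le_iff₀ (by linarith)]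
      exact mul_le_mul_of_nonneg_left (hM i) he.le
    have h2 := le_ciSup (bdd' (⨆ i, a i / b i)) i
    linarith
  · intro γ hγ
    refine le_of_forall_pos_le_add fun e he => ?_
    obtain ⟨i, hi⟩ := exists_lt_of_lt_ciSup (lt_of_lt_of_le (neg_lt_zero.2 he) hγ)
    have hbi : 0 < b i := by linarith [hb i]
    have h1 : γ - e ≤ a i / b i := by
      rw [le_div_iff₀ hbi]
      nlinarith [hb i]
    linarith [le_ciSup bdd i]

/-- The supremum that defines the Gittins index is a maximum. -/
theorem isGreatest_gittinsIndex (ν : ℝ) (v : ℝ≥0) {m : ℕ} (hm : 1 ≤ m) :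
    IsGreatest {γ | 0 ≤ stoppingValue ν v m γ} (gittinsIndex ν v m) := by
  have : Nonempty {τ // IsStoppingRule m τ} := ⟨⟨_, isStoppingRule_one hm⟩⟩
  have hμ : Integrable (fun ω : ℝ × (ℕ → ℝ) => ω.1) (armLaw ν v) := by
    have : Integrable (fun x : ℝ => x) (gaussianReal ν v) :=
      (memLp_id_gaussianReal 1).integrable le_rfl
    exact this.comp_fst _
  have hτ : ∀ τ : {τ // IsStoppingRule m τ}, Measurable fun ω => (τ.1 ω : ℝ) := fun τ =>
    measurable_from_top.comp τ.2.measurable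
  have hle : ∀ (τ : {τ // IsStoppingRule m τ}) ω, (τ.1 ω : ℝ) ≤ m := fun τ ω => by
    exact_mod_cast τ.2.le ω
  have hge : ∀ (τ : {τ // IsStoppingRule m τ}) ω, 1 ≤ (τ.1 ω : ℝ) := fun τ ω => by
    exact_mod_cast τ.2.one_le ω
  have hnorm : ∀ (τ : {τ // IsStoppingRule m τ}) ω, ‖(τ.1 ω : ℝ)‖ ≤ m := fun τ ω => by
    simpa using hle τ ω
  have hτi : ∀ τ : {τ // IsStoppingRule m τ}, Integrable (fun ω => (τ.1 ω : ℝ)) (armLaw ν v) :=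
    fun τ => Integrable.of_bound (hτ τ).aestronglyMeasurable m (Filter.Eventually.of_forall (hnorm τ))
  have hμτ : ∀ τ : {τ // IsStoppingRule m τ},
      Integrable (fun ω => ω.1 * (τ.1 ω : ℝ)) (armLaw ν v) :=
    fun τ => hμ.mul_bdd (hτ τ).aestronglyMeasurable (Filter.Eventually.of_forall (hnorm τ))
  have key := isGreatest_aux (fun τ : {τ // IsStoppingRule m τ} => ∫ ω, ω.1 * (τ.1 ω : ℝ) ∂(armLaw ν v))
    (fun τ => ∫ ω, (τ.1 ω : ℝ) ∂(armLaw ν v)) (∫ ω, |ω.1| * m ∂(armLaw ν v)) m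
    (fun τ => by
      refine (abs_integral_le_integral_abs).trans (integral_mono (hμτ τ).abs (hμ.abs.mul_const _) ?_)
      intro ω
      simp only [abs_mul]
      exact mul_le_mul_of_nonneg_left (hnorm τ ω) (abs_nonneg _))
    (fun τ => by simpa using integral_mono (integrable_const (1 : ℝ)) (hτi τ) (hge τ))
    (fun τ => by simpa using integral_mono (hτi τ) (integrable_const (m : ℝ)) (hle τ))
  have hval : ∀ γ, stoppingValue ν v m γ = ⨆ τ : {τ // IsStoppingRule m τ},
      ((∫ ω, ω.1 * (τ.1 ω : ℝ) ∂(armLaw ν v)) - γ * ∫ ω, (τ.1 ω : ℝ) ∂(armLaw ν v)) := by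
    intro γ
    unfold stoppingValue
    congr 1
    ext τ
    rw [← integral_const_mul, ← integral_sub (hμτ τ) ((hτi τ).const_mul γ)]
    congr 1
    ext ω
    ring
  unfold gittinsIndex
  simp only [hval]
  rw [key.csSup_eq]
  exact key

end Bandit

end

/-!
Write `G` for the index of arm `1` and give each arm its own infinite sequence of rewards, to be
consumed pull by pull; the regret of a strategy then depends only on how often it pulls each arm.
Let `π` be Bayes optimal and fix a seed for which its first choice is arm `0`; for almost every
seed, `π` is also optimal among the strategies with this seed. For a stopping time `T` of the
rewards of arm `1`, compare `π` with the strategy that pulls arm `1` until time `T`, then pulls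
arm `0` as often as `π` does before its own `T`-th pull of arm `1`, and then follows `π`. If `π`
pulls arm `1` altogether `N` times, its competitor pulls it `(T - N)⁺` more often. Since `N < n`
and stopping at `min T N` has no positive gain at the cost `G`, the difference
`E[(μ₁ - μ₀) (T - N)⁺]` of the regrets is at least
`E[(μ₁ - G) T] + (G - ν₀) P(T = n) - (n - 1) E[(μ₀ - G)⁺]`.

Take `T` with almost optimal gain `E[(μ₁ - G) T] ≈ 0`. On `{T = t}` with `t < n`, going on for one
more step does not help, so it is `{T = n}` that collects a fixed fraction of `G - ν₁`. Going on to
the horizon if and only if the first observation exceeds `ν₁` shows that `G - ν₁` is at least of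
order `v₁ / √(1 + v₁)`, while the posterior mean before the last observation has variance at most
of order `n v₁² / (1 + v₁)`; the Cauchy–Schwarz inequality thus gives `P(T = n) ≥ K / n³`. If
`G - ν₀` exceeded `√(2 c v₀ log n)` for a large `c`, then `(n - 1) E[(μ₀ - G)⁺]` would be less than
`(G - ν₀) K / n³` by a Gaussian tail bound, and the competitor would have the smaller regret.
-/

noncomputable section

namespace Bandit

section Fresh

variable {ι : Type*} [DecidableEq ι]

theorem measurePreserving_update {X : ι → Type*} [∀ i, MeasurableSpace (X i)]
    (μ : ∀ i, Measure (X i)) [∀ i, IsProbabilityMeasure (μ i)] (j : ι) :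
    MeasurePreserving (fun p : (∀ i, X i) × X j => Function.update p.1 j p.2)
      ((Measure.infinitePi μ).prod (μ j)) (Measure.infinitePi μ) := by
  refine ⟨measurable_update', Measure.eq_infinitePi _ fun s t ht => ?_⟩
  have hpre : (fun p : (∀ i, X i) × X j => Function.update p.1 j p.2) ⁻¹' (Set.pi s t) =
      Set.pi (s.erase j) t ×ˢ {z | j ∈ s → z ∈ t j} := by
    ext ⟨x, z⟩
    simp only [Set.mem_preimage, Set.mem_pi, Set.mem_prod, Finset.mem_coe, Finset.mem_erase,
      Set.mem_ofPred_eq]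
    refine ⟨fun h => ⟨fun i hi => ?_, fun hj => ?_⟩, fun h i hi => ?_⟩
    · simpa [hi.1] using h i hi.2
    · simpa using h j hj
    · rcases eq_or_ne i j with rfl | hij
      · simpa using h.2 hi
      · simpa [hij] using h.1 i ⟨hij, hi⟩
  rw [Measure.map_apply measurable_update' (.pi s.countable_toSet fun i _ => ht i), hpre,
    Measure.prod_prod, Measure.infinitePi_pi _ fun i _ => ht i]
  by_cases hj : j ∈ s
  · simp [hj, ← Finset.prod_erase_mul s _ hj]
  · simp [hj]

theorem infinitePi_inter_preimage_eval {X : ι → Type*} [∀ i, MeasurableSpace (X i)]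
    (μ : ∀ i, Measure (X i)) [∀ i, IsProbabilityMeasure (μ i)] {j : ι} {B : Set (∀ i, X i)}
    (hB : MeasurableSet B) (hupdate : ∀ x z, Function.update x j z ∈ B ↔ x ∈ B)
    {t : Set (X j)} (ht : MeasurableSet t) :
    Measure.infinitePi μ (B ∩ Function.eval j ⁻¹' t) = Measure.infinitePi μ B * μ j t := by
  rw [← (measurePreserving_update μ j).measure_preimage
    (hB.inter (measurable_pi_apply j ht)).nullMeasurableSet, ← Measure.prod_prod]
  congr 1
  ext ⟨x, z⟩
  simp [hupdate]

theorem measurable_apply_apply {J α β : Type*} [Countable J] [MeasurableSpace J]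
    [MeasurableSingletonClass J] [MeasurableSpace α] [MeasurableSpace β] {f : α → J → β}
    {j : α → J} (hf : Measurable f) (hj : Measurable j) : Measurable fun a => f a (j a) :=
  (measurable_from_prod_countable_right (f := fun q : J × (J → β) => q.2 q.1)
    fun i => measurable_pi_apply i).comp (hj.prodMk hf)

variable [Countable ι] [MeasurableSpace ι] [MeasurableSingletonClass ι] {α E : Type*}
  [MeasurableSpace α] [MeasurableSpace E]

/- If `H x` does not depend on the coordinate `j (H x)`, then this coordinate is still a fresh
sample when it is revealed after `H x`. -/
theorem map_prodMk_apply_infinitePi (P : Measure α) [IsProbabilityMeasure P] {H : (ι → α) → E}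
    (hH : Measurable H) {j : E → ι} (hj : Measurable j)
    (hupdate : ∀ x z, H (Function.update x (j (H x)) z) = H x) :
    (Measure.infinitePi fun _ : ι => P).map (fun x => (H x, x (j (H x)))) =
      ((Measure.infinitePi fun _ : ι => P).map H).prod P := by
  have hx : Measurable fun x : ι → α => x (j (H x)) :=
    measurable_apply_apply measurable_id (hj.comp hH)
  have : IsProbabilityMeasure ((Measure.infinitePi fun _ : ι => P).map H) :=
    Measure.isProbabilityMeasure_map hH.aemeasurable
  refine (Measure.prod_eq fun s t hs ht => ?_).symm
  let B : ι → Set (ι → α) := fun i => H ⁻¹' (s ∩ j ⁻¹' {i})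
  have hB : ∀ i, MeasurableSet (B i) := fun i => hH (hs.inter (hj (measurableSet_singleton i)))
  have update_mem : ∀ i x z, x ∈ B i → Function.update x i z ∈ B i := by
    rintro i x z ⟨hs, rfl : j (H x) = i⟩
    simp only [B, Set.mem_preimage, hupdate]
    exact ⟨hs, rfl⟩
  have update_mem_iff : ∀ i x z, Function.update x i z ∈ B i ↔ x ∈ B i := fun i x z =>
    ⟨fun h => by simpa using update_mem i _ (x i) h, update_mem i x z⟩
  have disjoint : Pairwise (Function.onFun Disjoint B) := fun a b hab =>
    Set.disjoint_left.2 fun _ ha hb => hab (ha.2.symm.trans hb.2)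
  have hinter : (fun x => (H x, x (j (H x)))) ⁻¹' (s ×ˢ t) = ⋃ i, B i ∩ Function.eval i ⁻¹' t := by
    ext x; simp [B]
  have hunion : H ⁻¹' s = ⋃ i, B i := by
    ext x; simp [B]
  rw [Measure.map_apply (hH.prodMk hx) (hs.prod ht), Measure.map_apply hH hs, hinter, hunion,
    measure_iUnion disjoint hB, ← ENNReal.tsum_mul_right,
    measure_iUnion (fun a b hab => (disjoint hab).mono Set.inter_subset_left Set.inter_subset_left)
      fun i => (hB i).inter (measurable_pi_apply i ht)]
  exact tsum_congr fun i => infinitePi_inter_preimage_eval _ (hB i) (update_mem_iff i) ht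

end Fresh

section Histories

variable {α : Type*} [MeasurableSpace α] {d t : ℕ}

/-- The number of pulls of arm `i` in a history. -/
def pulls (h : Fin t → Fin d × ℝ) (i : Fin d) : ℕ := (Finset.univ.filter fun s => (h s).1 = i).card

/-- The rewards in a history, indexed by the arm `i` and by the number `k` of earlier pulls of this
arm; entries that have not been observed are `0`. -/
def rewardTable : {t : ℕ} → (Fin t → Fin d × ℝ) → Fin d → ℕ → ℝ
  | 0, _, _, _ => 0
  | t + 1, h, i, k =>
    if (h (Fin.last t)).1 = i ∧ pulls (Fin.init h) i = k then (h (Fin.last t)).2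
    else rewardTable (Fin.init h) i k

@[simp] theorem pulls_zero (h : Fin 0 → Fin d × ℝ) (i : Fin d) : pulls h i = 0 := by
  simp [pulls]

@[simp] theorem pulls_snoc (h : Fin t → Fin d × ℝ) (p : Fin d × ℝ) (i : Fin d) :
    pulls (Fin.snoc h p : Fin (t + 1) → Fin d × ℝ) i = pulls h i + if p.1 = i then 1 else 0 := by
  simp only [pulls, Finset.card_filter, Fin.sum_univ_castSucc, Fin.snoc_castSucc, Fin.snoc_last]

@[simp] theorem rewardTable_snoc (h : Fin t → Fin d × ℝ) (p : Fin d × ℝ) (i : Fin d) (k : ℕ) :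
    rewardTable (Fin.snoc h p : Fin (t + 1) → Fin d × ℝ) i k =
      if p.1 = i ∧ pulls h i = k then p.2 else rewardTable h i k := by
  simp [rewardTable]

theorem sum_pulls (h : Fin t → Fin d × ℝ) : ∑ i, pulls h i = t := by
  simpa [pulls] using
    (Finset.card_eq_sum_card_fiberwise (f := fun s => (h s).1) (s := .univ) (t := .univ)
      fun _ _ => Finset.mem_coe.2 (Finset.mem_univ _)).symm

theorem pulls_le (h : Fin t → Fin d × ℝ) (i : Fin d) : pulls h i ≤ t :=
  (Finset.single_le_sum (fun _ _ => Nat.zero_le _) (Finset.mem_univ i)).trans_eq (sum_pulls h)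

theorem measurable_snoc {β : Type*} [MeasurableSpace β] {f : α → Fin t → β} {g : α → β}
    (hf : Measurable f) (hg : Measurable g) :
    Measurable fun a => (Fin.snoc (f a) (g a) : Fin (t + 1) → β) := by
  refine measurable_pi_lambda _ (Fin.lastCases ?_ fun s => ?_)
  · simpa using hg
  · simpa using measurable_pi_iff.1 hf s

@[fun_prop]
theorem measurable_pulls {f : α → Fin t → Fin d × ℝ} (hf : Measurable f) :
    Measurable fun a => pulls (f a) := by
  refine measurable_pi_lambda _ fun i => ?_
  simp only [pulls, Finset.card_filter]
  refine Finset.measurable_sum _ fun s _ => Measurable.ite ?_ measurable_const measurable_const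
  exact (measurable_pi_iff.1 hf s).fst (measurableSet_singleton i)

@[fun_prop]
theorem measurable_rewardTable {f : α → Fin t → Fin d × ℝ} (hf : Measurable f) :
    Measurable fun a => rewardTable (f a) := by
  refine measurable_pi_lambda _ fun i => measurable_pi_lambda _ fun k => ?_
  induction t with
  | zero => exact measurable_const
  | succ t ih =>
    have hinit : Measurable fun a => (Fin.init (f a) : Fin t → Fin d × ℝ) :=
      measurable_pi_lambda _ fun s => measurable_pi_iff.1 hf s.castSucc
    have hlast : Measurable fun a => f a (Fin.last t) := measurable_pi_iff.1 hf _
    simp only [rewardTable]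
    refine Measurable.ite (.inter ?_ ?_) hlast.snd (ih hinit)
    · exact hlast.fst (measurableSet_singleton i)
    · exact measurable_pi_iff.1 (measurable_pulls hinit) i (measurableSet_singleton k)

end Histories

namespace Strategy

variable {α : Type*} [MeasurableSpace α] {d : ℕ} (π : Strategy d) (u : unitInterval)

/-- The history before round `t` when the pull of arm `i` that follows `k` earlier ones yields the
reward `r i k`. -/
def tableHistory (r : Fin d → ℕ → ℝ) : (t : ℕ) → Fin t → Fin d × ℝ
  | 0 => Fin.elim0
  | t + 1 =>
    Fin.snoc (tableHistory r t)
      (π.act t u (tableHistory r t),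
        r (π.act t u (tableHistory r t)) (pulls (tableHistory r t) (π.act t u (tableHistory r t))))

@[simp] theorem pulls_tableHistory_succ (r : Fin d → ℕ → ℝ) (t : ℕ) (i : Fin d) :
    pulls (π.tableHistory u r (t + 1)) i =
      pulls (π.tableHistory u r t) i + if π.act t u (π.tableHistory u r t) = i then 1 else 0 := by
  simp [tableHistory]

theorem tableHistory_congr {r r' : Fin d → ℕ → ℝ} {t : ℕ}
    (h : ∀ i, ∀ k < pulls (π.tableHistory u r t) i, r i k = r' i k) :
    π.tableHistory u r' t = π.tableHistory u r t := by
  induction t with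
  | zero => rfl
  | succ t ih =>
    have hprefix := ih fun i k hk => h i k (hk.trans_le (by simp))
    simp only [tableHistory, hprefix]
    rw [h _ _ (by simp)]

theorem rewardTable_tableHistory (r : Fin d → ℕ → ℝ) {t : ℕ} {i : Fin d} {k : ℕ}
    (hk : k < pulls (π.tableHistory u r t) i) : rewardTable (π.tableHistory u r t) i k = r i k := by
  induction t with
  | zero => simp at hk
  | succ t ih =>
    rw [pulls_tableHistory_succ] at hk
    rw [tableHistory, rewardTable_snoc]
    split_ifs with hlast
    · rcases hlast with ⟨rfl, rfl⟩
      rfl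
    · refine ih (lt_of_le_of_ne ?_ fun hkt => ?_)
      · split_ifs at hk <;> omega
      · split_ifs at hk with hact
        · exact hlast ⟨hact, hkt.symm⟩
        · omega

theorem history_congr (θ : Fin d → ℝ) {ε ε' : ℕ → ℝ} {t : ℕ} (h : ∀ k < t, ε k = ε' k) :
    π.history u θ ε' t = π.history u θ ε t := by
  induction t with
  | zero => rfl
  | succ t ih =>
    simp only [history, ih fun k hk => h k (hk.trans t.lt_succ_self), h t t.lt_succ_self]

@[fun_prop]
theorem measurable_act_comp (t : ℕ) {f : α → unitInterval} {g : α → Fin t → Fin d × ℝ}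
    (hf : Measurable f) (hg : Measurable g) : Measurable fun a => π.act t (f a) (g a) :=
  (π.measurable_act t).comp (hf.prodMk hg)

@[fun_prop]
theorem measurable_history (t : ℕ) {f : α → unitInterval} {θ : α → Fin d → ℝ} {ε : α → ℕ → ℝ}
    (hf : Measurable f) (hθ : Measurable θ) (hε : Measurable ε) :
    Measurable fun a => π.history (f a) (θ a) (ε a) t := by
  induction t with
  | zero => exact measurable_const
  | succ t ih =>
    have hact := π.measurable_act_comp t hf ih
    exact measurable_snoc ih (hact.prodMk ((measurable_apply_apply hθ hact).add (by fun_prop)))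

@[fun_prop]
theorem measurable_tableHistory (t : ℕ) {f : α → unitInterval} {r : α → Fin d → ℕ → ℝ}
    (hf : Measurable f) (hr : Measurable r) :
    Measurable fun a => π.tableHistory (f a) (r a) t := by
  induction t with
  | zero => exact measurable_const
  | succ t ih =>
    have hact := π.measurable_act_comp t hf ih
    exact measurable_snoc ih (hact.prodMk (measurable_apply_apply (measurable_apply_apply hr hact)
      (measurable_apply_apply (measurable_pulls ih) hact)))

theorem map_history_succ (θ : Fin d → ℝ) (t : ℕ) :
    noise.map (fun ε => π.history u θ ε (t + 1)) =
      ((noise.map fun ε => π.history u θ ε t).prod (gaussianReal 0 1)).map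
        fun p => Fin.snoc p.1 (π.act t u p.1, θ (π.act t u p.1) + p.2) := by
  have hfresh := map_prodMk_apply_infinitePi (ι := ℕ) (gaussianReal 0 1)
    (H := fun ε => π.history u θ ε t) (by fun_prop) (j := fun _ => t) measurable_const
    fun x z => π.history_congr u θ fun k hk => (Function.update_of_ne hk.ne z x).symm
  rw [noise, ← hfresh, Measure.map_map]
  · rfl
  · exact measurable_snoc measurable_fst (by fun_prop)
  · fun_prop

theorem map_tableHistory_succ (θ : Fin d → ℝ) (t : ℕ) :
    (Measure.infinitePi fun _ : Fin d × ℕ => gaussianReal 0 1).map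
        (fun x => π.tableHistory u (fun i k => θ i + x (i, k)) (t + 1)) =
      (((Measure.infinitePi fun _ : Fin d × ℕ => gaussianReal 0 1).map
        fun x => π.tableHistory u (fun i k => θ i + x (i, k)) t).prod (gaussianReal 0 1)).map
        fun p => Fin.snoc p.1 (π.act t u p.1, θ (π.act t u p.1) + p.2) := by
  have hnext : Measurable fun h : Fin t → Fin d × ℝ => (π.act t u h, pulls h (π.act t u h)) := by
    have hact := π.measurable_act_comp t (measurable_const (a := u)) measurable_id
    exact hact.prodMk (measurable_apply_apply (measurable_pulls measurable_id) hact)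
  have hfresh := map_prodMk_apply_infinitePi (gaussianReal 0 1)
    (H := fun x => π.tableHistory u (fun i k => θ i + x (i, k)) t) (by fun_prop) hnext
    fun x z => π.tableHistory_congr u fun i k hk => by
      rw [Function.update_of_ne]
      rintro ⟨⟩
      exact hk.false
  rw [← hfresh, Measure.map_map]
  · rfl
  · exact measurable_snoc measurable_fst (by fun_prop)
  · exact Measurable.prodMk (by fun_prop)
      (measurable_apply_apply measurable_id (hnext.comp (by fun_prop)))

theorem map_history_eq_map_tableHistory (θ : Fin d → ℝ) (t : ℕ) :
    noise.map (fun ε => π.history u θ ε t) =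
      (Measure.infinitePi fun _ : Fin d × ℕ => gaussianReal 0 1).map
        (fun x => π.tableHistory u (fun i k => θ i + x (i, k)) t) := by
  induction t with
  | zero =>
    simp only [history, tableHistory, Measure.map_const, measure_univ]
  | succ t ih => rw [map_history_succ, map_tableHistory_succ, ih]

end Strategy

/-- The sequence of observations of an arm with mean `ω.1` and noise `ω.2`. -/
def rewards (ω : ℝ × (ℕ → ℝ)) : ℕ → ℝ := fun k => ω.1 + ω.2 k

@[fun_prop]
theorem measurable_rewards : Measurable rewards := by unfold rewards; fun_prop

theorem integrable_fst_armLaw (ν : ℝ) (v : ℝ≥0) :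
    Integrable (fun ω => ω.1) (armLaw ν v) :=
  ((memLp_id_gaussianReal 1).integrable le_rfl : Integrable id (gaussianReal ν v)).comp_fst _

theorem measurePreserving_curry_noise (ι : Type*) [Fintype ι] :
    MeasurePreserving (fun x : ι × ℕ → ℝ => Function.curry x)
      (Measure.infinitePi fun _ : ι × ℕ => gaussianReal 0 1) (Measure.pi fun _ : ι => noise) := by
  refine ⟨by unfold Function.curry; fun_prop, ?_⟩
  rw [← Measure.infinitePi_eq_pi]
  exact Measure.infinitePi_map_curry fun (_ : ι) (_ : ℕ) => gaussianReal 0 1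

theorem measurePreserving_zip_armLaw {ι : Type*} [Fintype ι] (ν : ι → ℝ) (v : ι → ℝ≥0) :
    MeasurePreserving (fun (p : (ι → ℝ) × (ι → ℕ → ℝ)) i => (p.1 i, p.2 i))
      ((Measure.pi fun i => gaussianReal (ν i) (v i)).prod (Measure.pi fun _ => noise))
      (Measure.pi fun i => armLaw (ν i) (v i)) :=
  (measurePreserving_arrowProdEquivProdArrow ℝ (ℕ → ℝ) ι (fun i => gaussianReal (ν i) (v i))
    fun _ => noise).symm

theorem integrable_iSup {ι Ω : Type*} [Finite ι] [MeasurableSpace Ω] {P : Measure Ω}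
    {f : ι → Ω → ℝ} (hf : ∀ i, Integrable (f i) P) : Integrable (fun ω => ⨆ i, f i ω) P := by
  cases nonempty_fintype ι
  cases isEmpty_or_nonempty ι
  · simp
  · refine (integrable_finsetSum Finset.univ fun i _ => (hf i).abs).mono'
      (AEMeasurable.iSup fun i => (hf i).aemeasurable).aestronglyMeasurable (.of_forall fun ω => ?_)
    obtain ⟨i, hi⟩ := exists_eq_ciSup_of_finite (f := fun i => f i ω)
    rw [← hi]
    exact Finset.single_le_sum (f := fun i => |f i ω|) (fun _ _ => abs_nonneg _)
      (Finset.mem_univ i)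

namespace Strategy

variable {d : ℕ} (π : Strategy d)

/-- The regret of `π` over `n` rounds when the seed is `u` and the mean and the noise of arm `i`
are given by `ω i`, with the noise indexed by the pulls of the arm. -/
def tableRegret (n : ℕ) (u : unitInterval) (ω : Fin d → ℝ × (ℕ → ℝ)) : ℝ :=
  ∑ i, ((⨆ j, (ω j).1) - (ω i).1) * pulls (π.tableHistory u (fun j => rewards (ω j)) n) i

theorem sum_sub_arm_eq (u : unitInterval) (θ : Fin d → ℝ) (ε : ℕ → ℝ) (s : ℝ) (n : ℕ) :
    ∑ t ∈ Finset.range n, (s - θ (π.arm u θ ε t)) =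
      ∑ i, (s - θ i) * pulls (π.history u θ ε n) i := by
  induction n with
  | zero => simp
  | succ n ih =>
    rw [Finset.sum_range_succ, ih]
    simp [history, arm, mul_add, Finset.sum_add_distrib]

theorem map_history_prod (θ : Fin d → ℝ) (t : ℕ) :
    ((volume : Measure unitInterval).prod noise).map (fun p => π.history p.1 θ p.2 t) =
      ((Measure.pi fun _ : Fin d => noise).prod (volume : Measure unitInterval)).map
        fun p => π.tableHistory p.2 (fun i => rewards (θ i, p.1 i)) t := by
  have hrewards : ∀ u, noise.map (fun ε => π.history u θ ε t) =
      (Measure.pi fun _ : Fin d => noise).map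
        fun ε => π.tableHistory u (fun i => rewards (θ i, ε i)) t := fun u => by
    rw [map_history_eq_map_tableHistory, ← (measurePreserving_curry_noise (Fin d)).map_eq,
      Measure.map_map (by fun_prop) (measurePreserving_curry_noise _).measurable]
    rfl
  ext s hs
  rw [Measure.map_apply (by fun_prop) hs, Measure.map_apply (by fun_prop) hs,
    Measure.prod_apply (hs.preimage (by fun_prop)),
    Measure.prod_apply_symm (hs.preimage (by fun_prop))]
  refine lintegral_congr fun u => ?_
  have := congrArg (· s) (hrewards u)
  rwa [Measure.map_apply (by fun_prop) hs, Measure.map_apply (by fun_prop) hs] at this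

theorem regret_eq_integral_tableRegret (n : ℕ) (θ : Fin d → ℝ) :
    π.regret n θ = ∫ p, π.tableRegret n p.2 (fun i => (θ i, p.1 i))
      ∂((Measure.pi fun _ : Fin d => noise).prod (volume : Measure unitInterval)) := by
  have hmeas : Measurable fun h : Fin n → Fin d × ℝ =>
      ∑ i, ((⨆ j, θ j) - θ i) * (pulls h i : ℝ) := by fun_prop
  simp only [regret, sum_sub_arm_eq]
  rw [← integral_map (φ := fun p : unitInterval × (ℕ → ℝ) => π.history p.1 θ p.2 n)
    (by fun_prop) hmeas.aestronglyMeasurable, map_history_prod,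
    integral_map (by fun_prop) hmeas.aestronglyMeasurable]
  rfl

theorem integrable_tableRegret (n : ℕ) (ν : Fin d → ℝ) (v : Fin d → ℝ≥0) :
    Integrable (fun p => π.tableRegret n p.2 p.1)
      ((Measure.pi fun i => armLaw (ν i) (v i)).prod (volume : Measure unitInterval)) := by
  have hmean : ∀ i, Integrable (fun p : (Fin d → ℝ × (ℕ → ℝ)) × unitInterval => (p.1 i).1)
      ((Measure.pi fun i => armLaw (ν i) (v i)).prod volume) := fun i =>
    ((measurePreserving_eval (fun i => armLaw (ν i) (v i)) i).integrable_comp_of_integrable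
      (integrable_fst_armLaw _ _)).comp_fst _
  refine integrable_finsetSum _ fun i _ => ((integrable_iSup hmean).sub (hmean i)).mul_bdd
    (c := n) (Measurable.aestronglyMeasurable (by fun_prop)) (.of_forall fun p => ?_)
  simpa using pulls_le _ i

theorem bayesRegret_eq_integral_tableRegret (n : ℕ) (ν : Fin d → ℝ) (v : Fin d → ℝ≥0) :
    π.bayesRegret n (gaussianPrior ν v) =
      ∫ u, ∫ ω, π.tableRegret n u ω ∂(Measure.pi fun i => armLaw (ν i) (v i)) := by
  have hzip := ((measurePreserving_zip_armLaw ν v).prod (.id (volume : Measure unitInterval))).comp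
    (measurePreserving_prodAssoc _ _ _).symm
  have hint := π.integrable_tableRegret n ν v
  rw [← integral_prod_symm _ hint, ← hzip.map_eq]
  rw [← hzip.map_eq] at hint
  rw [integral_map hzip.aemeasurable hint.1]
  refine .trans ?_
    (integral_prod _ ((integrable_map_measure hint.1 hzip.aemeasurable).1 hint)).symm
  simp only [bayesRegret, regret_eq_integral_tableRegret]
  rfl

end Strategy

namespace Strategy

variable {d : ℕ}

open Classical in
/-- The strategy that follows `σ` when the seed lies in `U` and `π` otherwise. -/
def piecewise (U : Set unitInterval) (hU : MeasurableSet U) (σ π : Strategy d) : Strategy d where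
  act t u h := if u ∈ U then σ.act t u h else π.act t u h
  measurable_act t := Measurable.ite (measurable_fst hU) (σ.measurable_act t) (π.measurable_act t)

open Classical in
theorem tableHistory_piecewise {U : Set unitInterval} (hU : MeasurableSet U) (σ π : Strategy d)
    (u : unitInterval) (r : Fin d → ℕ → ℝ) (t : ℕ) :
    (piecewise U hU σ π).tableHistory u r t =
      if u ∈ U then σ.tableHistory u r t else π.tableHistory u r t := by
  induction t with
  | zero => simp [tableHistory]
  | succ t ih => by_cases hu : u ∈ U <;> simp_all [tableHistory, piecewise]

open Classical in
theorem tableRegret_piecewise {U : Set unitInterval} (hU : MeasurableSet U) (σ π : Strategy d)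
    (n : ℕ) (u : unitInterval) (ω : Fin d → ℝ × (ℕ → ℝ)) :
    (piecewise U hU σ π).tableRegret n u ω =
      if u ∈ U then σ.tableRegret n u ω else π.tableRegret n u ω := by
  simp only [tableRegret, tableHistory_piecewise]
  split_ifs <;> rfl

theorem measurable_integral_tableRegret (π : Strategy d) (n : ℕ) (ν : Fin d → ℝ)
    (v : Fin d → ℝ≥0) :
    Measurable fun u => ∫ ω, π.tableRegret n u ω ∂(Measure.pi fun i => armLaw (ν i) (v i)) := by
  have : Measurable fun p : unitInterval × (Fin d → ℝ × (ℕ → ℝ)) => π.tableRegret n p.1 p.2 := by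
    unfold tableRegret; fun_prop
  exact this.stronglyMeasurable.integral_prod_right.measurable

/- Otherwise, switching to `σ` exactly on the seeds where `σ` does better would be an
improvement. -/
theorem IsBayesOptimal.ae_integral_tableRegret_le {π : Strategy d} {n : ℕ} {ν : Fin d → ℝ}
    {v : Fin d → ℝ≥0} (hπ : π.IsBayesOptimal n (gaussianPrior ν v)) (σ : Strategy d) :
    ∀ᵐ u, ∫ ω, (π.tableRegret n u ω - σ.tableRegret n u ω)
      ∂(Measure.pi fun i => armLaw (ν i) (v i)) ≤ 0 := by
  set a : Strategy d → unitInterval → ℝ := fun ρ u =>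
    ∫ ω, ρ.tableRegret n u ω ∂(Measure.pi fun i => armLaw (ν i) (v i))
  have ha : ∀ ρ, Integrable (a ρ) := fun ρ => (ρ.integrable_tableRegret n ν v).integral_prod_right
  have hU : MeasurableSet {u | a σ u < a π u} :=
    measurableSet_lt (σ.measurable_integral_tableRegret n ν v)
      (π.measurable_integral_tableRegret n ν v)
  set ρ := piecewise {u | a σ u < a π u} hU σ π
  have hmin : ∀ u, a ρ u = min (a π u) (a σ u) := fun u => by
    by_cases hu : a σ u < a π u
    · refine .trans (integral_congr_ae (.of_forall fun ω => ?_)) (min_eq_right hu.le).symm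
      exact (tableRegret_piecewise hU σ π n u ω).trans (if_pos hu)
    · refine .trans (integral_congr_ae (.of_forall fun ω => ?_)) (min_eq_left (not_lt.1 hu)).symm
      exact (tableRegret_piecewise hU σ π n u ω).trans (if_neg hu)
  have hle : ∀ u, 0 ≤ a π u - a ρ u := fun u => sub_nonneg.2 ((hmin u).trans_le (min_le_left _ _))
  have hint : ∫ u, (a π u - a ρ u) = 0 := by
    refine le_antisymm ?_ (integral_nonneg hle)
    have := hπ ρ
    simp only [bayesRegret_eq_integral_tableRegret] at this
    rw [integral_sub (ha π) (ha ρ)]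
    exact sub_nonpos.2 this
  filter_upwards [(integral_eq_zero_iff_of_nonneg hle ((ha π).sub (ha ρ))).1 hint,
    (π.integrable_tableRegret n ν v).prod_left_ae, (σ.integrable_tableRegret n ν v).prod_left_ae]
    with u hu hπu hσu
  rw [integral_sub hπu hσu]
  exact sub_nonpos.2 (min_eq_left_iff.1 ((hmin u).symm.trans (sub_eq_zero.1 hu).symm))

end Strategy

/-- A functional `T` of a sequence that is determined by the first `T` entries, as is a stopping
time of a sequence of observations. -/
def NonAnticipating (T : (ℕ → ℝ) → ℕ) : Prop :=
  ∀ y y', (∀ k < T y, y k = y' k) → T y' = T y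

namespace Strategy

variable {d : ℕ} (u : unitInterval)

theorem monotone_pulls_tableHistory (π : Strategy d) (r : Fin d → ℕ → ℝ) (i : Fin d) :
    Monotone fun t => pulls (π.tableHistory u r t) i :=
  monotone_nat_of_le_succ fun t => by simp

theorem exists_pulls_tableHistory_eq (π : Strategy d) (r : Fin d → ℕ → ℝ) {i : Fin d} {K t : ℕ}
    (hK : K ≤ pulls (π.tableHistory u r t) i) :
    ∃ s ≤ t, pulls (π.tableHistory u r s) i = K := by
  induction t with
  | zero => exact ⟨0, le_rfl, (Nat.le_zero.1 hK).symm⟩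
  | succ t ih =>
    by_cases ht : K ≤ pulls (π.tableHistory u r t) i
    · obtain ⟨s, hs, hsK⟩ := ih ht
      exact ⟨s, hs.trans t.le_succ, hsK⟩
    · refine ⟨t + 1, le_rfl, le_antisymm ?_ hK⟩
      rw [pulls_tableHistory_succ]
      split_ifs <;> omega

variable (π : Strategy 2) {T : (ℕ → ℝ) → ℕ}

theorem pulls_zero_add_pulls_one {t : ℕ} (h : Fin t → Fin 2 × ℝ) : pulls h 0 + pulls h 1 = t :=
  (Fin.sum_univ_two _).symm.trans (sum_pulls h)

theorem le_pulls_tableHistory_congr {r r' : Fin 2 → ℕ → ℝ} {K t : ℕ}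
    (h₀ : ∀ k < t - K, r 0 k = r' 0 k) (h₁ : ∀ k < K, r 1 k = r' 1 k)
    (hK : K ≤ pulls (π.tableHistory u r t) 1) : K ≤ pulls (π.tableHistory u r' t) 1 := by
  obtain ⟨s, hst, hs⟩ := π.exists_pulls_tableHistory_eq u r hK
  have hsum := pulls_zero_add_pulls_one (π.tableHistory u r s)
  have hcongr : π.tableHistory u r' s = π.tableHistory u r s :=
    π.tableHistory_congr u
      (Fin.forall_fin_two.2 ⟨fun k hk => h₀ k (by omega), fun k hk => h₁ k (by omega)⟩)
  calc K = pulls (π.tableHistory u r' s) 1 := by rw [hcongr, hs]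
    _ ≤ pulls (π.tableHistory u r' t) 1 := π.monotone_pulls_tableHistory u r' 1 hst

/-- The arm pulled in round `t` by the strategy `exploreFirst` when the rewards are given by the
table `r`. -/
def exploreArm (T : (ℕ → ℝ) → ℕ) (t : ℕ) (r : Fin 2 → ℕ → ℝ) : Fin 2 :=
  if t < T (r 1) ∨
    T (r 1) ≤ pulls (π.tableHistory u r t) 1 ∧ π.act t u (π.tableHistory u r t) = 1
  then 1 else 0

theorem measurable_exploreArm (hT : Measurable T) (t : ℕ) :
    Measurable fun p : unitInterval × (Fin 2 → ℕ → ℝ) => π.exploreArm p.1 T t p.2 := by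
  have hTr : Measurable fun p : unitInterval × (Fin 2 → ℕ → ℝ) => T (p.2 1) := by fun_prop
  refine Measurable.ite (.union ?_ (.inter ?_ ?_)) measurable_const measurable_const
  · exact measurableSet_lt measurable_const hTr
  · exact measurableSet_le hTr (by fun_prop)
  · exact π.measurable_act_comp t measurable_fst (by fun_prop) (measurableSet_singleton 1)

/-- The strategy that pulls arm `1` until the stopping time `T` and then pulls arm `0`, except that
it resumes following `π` once `π` would itself have pulled arm `1` at least `T` times. In this way
each arm is pulled as often as by `π`, but for the additional pulls of arm `1` enforced by `T`. -/
def exploreFirst (T : (ℕ → ℝ) → ℕ) (hT : Measurable T) : Strategy 2 where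
  act t u h := π.exploreArm u T t (rewardTable h)
  measurable_act t := (π.measurable_exploreArm hT t).comp
    (measurable_fst.prodMk (measurable_rewardTable measurable_snd))

theorem exploreArm_congr (hT : NonAnticipating T) {t N : ℕ} {r r' : Fin 2 → ℕ → ℝ}
    (hN : N = max (pulls (π.tableHistory u r t) 1) (min t (T (r 1))))
    (h₀ : ∀ k < t - N, r 0 k = r' 0 k) (h₁ : ∀ k < N, r 1 k = r' 1 k) :
    π.exploreArm u T t r' = π.exploreArm u T t r := by
  by_cases ht : t < T (r 1)
  · have ht' : t < T (r' 1) := by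
      by_contra! hle
      have := hT (r' 1) (r 1) fun k hk => (h₁ k (by omega)).symm
      omega
    simp only [exploreArm, ht, ht', true_or]
  have hT' : T (r' 1) = T (r 1) := hT _ _ fun k hk => h₁ k (by omega)
  have hsum := pulls_zero_add_pulls_one (π.tableHistory u r t)
  by_cases hTN : T (r 1) ≤ pulls (π.tableHistory u r t) 1
  · have hcongr : π.tableHistory u r' t = π.tableHistory u r t :=
      π.tableHistory_congr u
        (Fin.forall_fin_two.2 ⟨fun k hk => h₀ k (by omega), fun k hk => h₁ k (by omega)⟩)
    simp only [exploreArm, hT', hcongr]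
  · have hTN' : ¬ T (r 1) ≤ pulls (π.tableHistory u r' t) 1 := fun hle =>
      hTN (π.le_pulls_tableHistory_congr u (fun k hk => (h₀ k (by omega)).symm)
        (fun k hk => (h₁ k (by omega)).symm) hle)
    simp only [exploreArm, hT', ht, hTN, hTN', false_and, or_self]

theorem pulls_exploreFirst (hTm : Measurable T) (hT : NonAnticipating T) (r : Fin 2 → ℕ → ℝ)
    (t : ℕ) :
    pulls ((π.exploreFirst T hTm).tableHistory u r t) 1 =
      max (pulls (π.tableHistory u r t) 1) (min t (T (r 1))) := by
  induction t with
  | zero => simp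
  | succ t ih =>
    set σ := π.exploreFirst T hTm
    have hsum := pulls_zero_add_pulls_one (σ.tableHistory u r t)
    have hact : σ.act t u (σ.tableHistory u r t) = π.exploreArm u T t r :=
      π.exploreArm_congr u hT rfl
        (fun k hk => (σ.rewardTable_tableHistory u r (by omega)).symm)
        fun k hk => (σ.rewardTable_tableHistory u r (by omega)).symm
    have hle := pulls_le (π.tableHistory u r t) 1
    rw [pulls_tableHistory_succ, pulls_tableHistory_succ, ih, hact, exploreArm]
    grind

theorem pulls_exploreFirst_eq_add (hTm : Measurable T) (hT : NonAnticipating T)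
    (r : Fin 2 → ℕ → ℝ) {n : ℕ} (hn : T (r 1) ≤ n) :
    pulls ((π.exploreFirst T hTm).tableHistory u r n) 1 =
      pulls (π.tableHistory u r n) 1 + (T (r 1) - pulls (π.tableHistory u r n) 1) := by
  rw [π.pulls_exploreFirst u hTm hT, min_eq_right hn]
  omega

end Strategy

section Observations

theorem NonAnticipating.min {S T : (ℕ → ℝ) → ℕ} (hS : NonAnticipating S)
    (hT : NonAnticipating T) : NonAnticipating fun y => min (S y) (T y) := by
  intro y y' hy
  have hS' := hS y' y
  have hT' := hT y' y
  grind [NonAnticipating]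

theorem Strategy.nonAnticipating_pulls (π : Strategy 2) (u : unitInterval) (r : ℕ → ℝ) (t : ℕ) :
    NonAnticipating fun y => pulls (π.tableHistory u ![r, y] t) 1 := fun y y' hy => by
  simp only [π.tableHistory_congr u (r := ![r, y]) (r' := ![r, y'])
    (Fin.forall_fin_two.2 ⟨fun _ _ => rfl, hy⟩)]

theorem measurableSet_comap_obs {t : ℕ} {S : Set (ℕ → ℝ)} (hS : MeasurableSet S)
    (h : ∀ y y', (∀ k < t, y k = y' k) → y ∈ S → y' ∈ S) :
    MeasurableSet[.comap (obs t) inferInstance] (rewards ⁻¹' S) := by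
  let pad : (Fin t → ℝ) → ℕ → ℝ := fun z k => if hk : k < t then z ⟨k, hk⟩ else 0
  have hpad : Measurable pad := measurable_pi_lambda _ fun k => by
    by_cases hk : k < t
    · simpa only [pad, hk, dite_true] using measurable_pi_apply _
    · simp only [pad, hk, dite_false, measurable_const]
  have hpad_obs : ∀ ω, ∀ k < t, pad (obs t ω) k = rewards ω k := fun ω k hk => by
    simp only [pad, hk, dite_true, obs, rewards]
  refine ⟨pad ⁻¹' S, hpad hS, ?_⟩
  ext ω
  exact ⟨h _ _ (hpad_obs ω), h _ _ fun k hk => (hpad_obs ω k hk).symm⟩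

end Observations

/-- `T` is a stopping time `1 ≤ T ≤ m` of a sequence of observations, as a functional of that
sequence; by `IsStoppingRule.isObsRule` every stopping rule arises in this way. -/
structure IsObsRule (m : ℕ) (T : (ℕ → ℝ) → ℕ) : Prop where
  measurable : Measurable T
  nonAnticipating : NonAnticipating T
  one_le : ∀ y, 1 ≤ T y
  le : ∀ y, T y ≤ m

section ObsRule

variable {m : ℕ} {τ : ℝ × (ℕ → ℝ) → ℕ} {T : (ℕ → ℝ) → ℕ}

theorem IsObsRule.isStoppingRule (h : IsObsRule m T) : IsStoppingRule m fun ω => T (rewards ω) where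
  one_le _ := h.one_le _
  le _ := h.le _
  measurableSet_eq t := measurableSet_comap_obs (h.measurable (measurableSet_singleton t))
    fun y y' hy hT => (h.nonAnticipating y y' fun k hk => hy k (hk.trans_eq hT)).trans hT

/-- The last observation is not needed to decide whether the whole horizon is used. -/
theorem IsObsRule.measurableSet_eq_horizon (h : IsObsRule m T) :
    MeasurableSet[.comap (obs (m - 1)) inferInstance] {ω | T (rewards ω) = m} := by
  refine measurableSet_comap_obs (h.measurable (measurableSet_singleton m)) fun y y' hy hT => ?_
  by_contra hne
  have hlt : T y' < m := (h.le y').lt_of_ne hne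
  exact hlt.ne ((h.nonAnticipating y' y fun k hk => (hy k (by omega)).symm).symm.trans hT)

theorem IsStoppingRule.eq_of_eqOn (h : IsStoppingRule m τ) {ω ω' : ℝ × (ℕ → ℝ)}
    (hω : ∀ k < τ ω, rewards ω k = rewards ω' k) : τ ω' = τ ω := by
  obtain ⟨s, -, hs⟩ := h.measurableSet_eq (τ ω)
  have hobs : obs (τ ω) ω' = obs (τ ω) ω := funext fun k => (hω k k.2).symm
  have hmem : ω' ∈ obs (τ ω) ⁻¹' s := by
    rw [Set.mem_preimage, hobs, ← Set.mem_preimage, hs, Set.mem_ofPred_eq]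
  rwa [hs] at hmem

theorem rewards_zero_mk (y : ℕ → ℝ) : rewards (0, y) = y := funext fun _ => zero_add _

theorem IsStoppingRule.apply_zero_rewards (h : IsStoppingRule m τ) (ω : ℝ × (ℕ → ℝ)) :
    τ (0, rewards ω) = τ ω :=
  h.eq_of_eqOn fun k _ => by rw [rewards_zero_mk]

theorem IsStoppingRule.isObsRule (h : IsStoppingRule m τ) : IsObsRule m fun y => τ (0, y) where
  measurable := h.measurable.comp measurable_prodMk_left
  nonAnticipating y y' hy := h.eq_of_eqOn fun k hk => by simpa only [rewards_zero_mk] using hy k hk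
  one_le _ := h.one_le _
  le _ := h.le _

theorem isObsRule_const {k : ℕ} (hk : 1 ≤ k) (hkm : k ≤ m) : IsObsRule m fun _ => k where
  measurable := measurable_const
  nonAnticipating _ _ _ := rfl
  one_le _ := hk
  le _ := hkm

theorem IsObsRule.extend (h : IsObsRule m T) {t : ℕ} (ht : t < m) :
    IsObsRule m fun y => if T y = t then t + 1 else T y where
  measurable := .ite (h.measurable (measurableSet_singleton t)) measurable_const h.measurable
  nonAnticipating y y' hy := by
    have hT : T y' = T y := h.nonAnticipating y y' fun k hk => hy k (by grind)
    simp only [hT]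
  one_le y := by grind [h.one_le y]
  le y := by grind [h.le y]

end ObsRule

/-- The expected gain `E[(μ - γ) T]` of observing an arm with unknown mean `μ ∼ N(ν, v)` until
time `T` at the cost `γ` per observation. -/
def gain (ν : ℝ) (v : ℝ≥0) (γ : ℝ) (T : (ℕ → ℝ) → ℕ) : ℝ :=
  ∫ ω, (ω.1 - γ) * (T (rewards ω) : ℝ) ∂(armLaw ν v)

section Gain

variable {ν : ℝ} {v : ℝ≥0} {m : ℕ} {T : (ℕ → ℝ) → ℕ}

theorem integrable_sub_mul (γ : ℝ) {f : ℝ × (ℕ → ℝ) → ℕ} (hf : Measurable f)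
    (hle : ∀ ω, f ω ≤ m) : Integrable (fun ω => (ω.1 - γ) * (f ω : ℝ)) (armLaw ν v) :=
  ((integrable_fst_armLaw ν v).sub (integrable_const γ)).mul_bdd (c := m)
    (measurable_from_top.comp hf).aestronglyMeasurable
    (.of_forall fun ω => by simpa only [Real.norm_natCast, Nat.cast_le] using hle ω)

theorem IsObsRule.gain_le_stoppingValue (h : IsObsRule m T) (γ : ℝ) :
    gain ν v γ T ≤ stoppingValue ν v m γ := by
  have hsub : Integrable (fun ω => ω.1 - γ) (armLaw ν v) :=
    (integrable_fst_armLaw ν v).sub (integrable_const γ)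
  have hbdd : BddAbove (Set.range fun τ : {τ // IsStoppingRule m τ} =>
      ∫ ω, (ω.1 - γ) * (τ.1 ω : ℝ) ∂(armLaw ν v)) := by
    refine ⟨∫ ω, |ω.1 - γ| * m ∂(armLaw ν v), ?_⟩
    rintro _ ⟨⟨τ, hτ⟩, rfl⟩
    refine integral_mono (integrable_sub_mul γ hτ.measurable hτ.le) (hsub.abs.mul_const _)
      fun ω => ?_
    have hle : (τ ω : ℝ) ≤ m := mod_cast hτ.le ω
    exact mul_le_mul (le_abs_self _) hle (Nat.cast_nonneg _) (abs_nonneg _)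
  exact le_ciSup hbdd ⟨_, h.isStoppingRule⟩

theorem gain_sub_mul_le {γ γ' : ℝ} (hγ : γ ≤ γ') (hT : Measurable T) (hle : ∀ y, T y ≤ m) :
    gain ν v γ T - (γ' - γ) * m ≤ gain ν v γ' T := by
  have hint (γ : ℝ) : Integrable (fun ω => (ω.1 - γ) * (T (rewards ω) : ℝ)) (armLaw ν v) :=
    integrable_sub_mul γ (by fun_prop) fun ω => hle _
  have hmono := integral_mono ((hint γ).sub (integrable_const ((γ' - γ) * m))) (hint γ')
    fun ω => by
      have hTm : (T (rewards ω) : ℝ) ≤ m := mod_cast hle (rewards ω)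
      simp only [Pi.sub_apply]
      linarith [mul_le_mul_of_nonneg_left hTm (sub_nonneg.2 hγ)]
  rwa [integral_sub' (hint γ) (integrable_const _), integral_const, probReal_univ, one_smul]
    at hmono

/-- A rule with a positive gain would still have a nonnegative gain at a slightly larger cost. -/
theorem IsObsRule.gain_gittinsIndex_nonpos (h : IsObsRule m T) :
    gain ν v (gittinsIndex ν v m) T ≤ 0 := by
  have hm : 1 ≤ m := (h.one_le 0).trans (h.le 0)
  have hm0 : (0 : ℝ) < m := by exact_mod_cast hm
  set G := gittinsIndex ν v m
  by_contra! hpos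
  have hδ : 0 < gain ν v G T / m := div_pos hpos hm0
  have hgain : 0 ≤ gain ν v (G + gain ν v G T / m) T := by
    have := gain_sub_mul_le (ν := ν) (v := v) (le_add_of_nonneg_right hδ.le : G ≤ _)
      h.measurable h.le
    rwa [add_sub_cancel_left, div_mul_cancel₀ _ hm0.ne', sub_self] at this
  have hle := (isGreatest_gittinsIndex ν v hm).2 (hgain.trans (h.gain_le_stoppingValue _))
  linarith

theorem NonAnticipating.gain_gittinsIndex_nonpos (hT : NonAnticipating T) (hTm : Measurable T)
    (hle : ∀ y, T y ≤ m) : gain ν v (gittinsIndex ν v m) T ≤ 0 := by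
  by_cases h : ∃ y, T y = 0
  · obtain ⟨y, hy⟩ := h
    have hT0 : ∀ y', T y' = 0 := fun y' => (hT y y' fun k hk => by omega).trans hy
    simp only [gain, hT0, Nat.cast_zero, mul_zero, integral_zero, le_refl]
  · push Not at h
    exact IsObsRule.gain_gittinsIndex_nonpos
      ⟨hTm, hT, fun y => Nat.one_le_iff_ne_zero.2 (h y), hle⟩

theorem exists_isObsRule_neg_lt_gain (ν : ℝ) (v : ℝ≥0) (hm : 1 ≤ m) {ε : ℝ} (hε : 0 < ε) :
    ∃ T, IsObsRule m T ∧ -ε < gain ν v (gittinsIndex ν v m) T := by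
  have : Nonempty {τ // IsStoppingRule m τ} := ⟨⟨_, isStoppingRule_one hm⟩⟩
  obtain ⟨⟨τ, hτ⟩, hlt⟩ := exists_lt_of_lt_ciSup
    ((neg_lt_zero.2 hε).trans_le (isGreatest_gittinsIndex ν v hm).1)
  refine ⟨_, hτ.isObsRule, ?_⟩
  simpa only [gain, hτ.apply_zero_rewards] using hlt

theorem integral_fst_armLaw (ν : ℝ) (v : ℝ≥0) : ∫ ω, ω.1 ∂(armLaw ν v) = ν := by
  rw [armLaw, integral_fun_fst (f := fun x => x)]
  simp

theorem gain_const (γ : ℝ) (k : ℕ) : gain ν v γ (fun _ => k) = (ν - γ) * k := by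
  rw [gain, integral_mul_const, integral_sub (integrable_fst_armLaw ν v) (integrable_const γ),
    integral_fst_armLaw, integral_const, probReal_univ, one_smul]

theorem le_gittinsIndex (ν : ℝ) (v : ℝ≥0) (hm : 1 ≤ m) : ν ≤ gittinsIndex ν v m := by
  have := (isObsRule_const le_rfl hm).gain_gittinsIndex_nonpos (ν := ν) (v := v)
  rw [gain_const] at this
  simpa using this

end Gain

section Horizon

variable {ν : ℝ} {v : ℝ≥0} {n : ℕ} {T : (ℕ → ℝ) → ℕ}

theorem IsObsRule.measurableSet_eq (h : IsObsRule n T) (t : ℕ) :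
    MeasurableSet {ω | T (rewards ω) = t} :=
  (h.measurable.comp measurable_rewards) (measurableSet_singleton t)

/-- Observing the arm once more when `T = t` cannot make the gain positive. -/
theorem IsObsRule.setIntegral_sub_gittinsIndex_le (h : IsObsRule n T) {t : ℕ} (ht : t < n) :
    ∫ ω in {ω | T (rewards ω) = t}, (ω.1 - gittinsIndex ν v n) ∂(armLaw ν v) ≤
      -gain ν v (gittinsIndex ν v n) T := by
  set G := gittinsIndex ν v n
  have hsub : Integrable (fun ω => ω.1 - G) (armLaw ν v) :=
    (integrable_fst_armLaw ν v).sub (integrable_const G)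
  have hext : gain ν v G (fun y => if T y = t then t + 1 else T y) =
      gain ν v G T + ∫ ω in {ω | T (rewards ω) = t}, (ω.1 - G) ∂(armLaw ν v) := by
    have hT := h.measurable
    rw [← integral_indicator (h.measurableSet_eq t), gain, gain, ← integral_add
      (integrable_sub_mul G (by fun_prop) fun ω => h.le _) (hsub.indicator (h.measurableSet_eq t))]
    refine integral_congr_ae (.of_forall fun ω => ?_)
    by_cases hω : T (rewards ω) = t
    · simp only [hω, if_true, Set.indicator, Set.mem_ofPred_eq]
      push_cast
      ring
    · simp only [hω, if_false, Set.indicator, Set.mem_ofPred_eq, add_zero]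
  linarith [hext ▸ (h.extend ht).gain_gittinsIndex_nonpos (ν := ν) (v := v)]

theorem IsObsRule.gain_eq_sum (h : IsObsRule n T) (γ : ℝ) :
    gain ν v γ T = (ν - γ) + ∑ t ∈ Finset.Icc 1 n, ((t : ℝ) - 1) *
      ∫ ω in {ω | T (rewards ω) = t}, (ω.1 - γ) ∂(armLaw ν v) := by
  have hsub : Integrable (fun ω => ω.1 - γ) (armLaw ν v) :=
    (integrable_fst_armLaw ν v).sub (integrable_const γ)
  have hind (t : ℕ) : Integrable (fun ω => ((t : ℝ) - 1) *
      {ω | T (rewards ω) = t}.indicator (fun ω => ω.1 - γ) ω) (armLaw ν v) :=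
    (hsub.indicator (h.measurableSet_eq t)).const_mul _
  have hpoint (ω : ℝ × (ℕ → ℝ)) : (ω.1 - γ) * (T (rewards ω) : ℝ) = (ω.1 - γ) +
      ∑ t ∈ Finset.Icc 1 n, ((t : ℝ) - 1) *
        {ω | T (rewards ω) = t}.indicator (fun ω => ω.1 - γ) ω := by
    rw [Finset.sum_eq_single_of_mem (T (rewards ω)) (Finset.mem_Icc.2 ⟨h.one_le _, h.le _⟩)]
    · simp only [Set.indicator, Set.mem_ofPred_eq, if_true]
      ring
    · intro t _ ht
      simp only [Set.indicator, Set.mem_ofPred_eq, ht.symm, if_false, mul_zero]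
  simp only [gain, hpoint]
  rw [integral_add hsub (integrable_finsetSum _ fun t _ => hind t),
    integral_finsetSum _ fun t _ => hind t,
    integral_sub (integrable_fst_armLaw ν v) (integrable_const _), integral_fst_armLaw,
    integral_const, probReal_univ, one_smul]
  simp only [integral_const_mul, integral_indicator (h.measurableSet_eq _)]

theorem IsObsRule.gittinsIndex_sub_le (h : IsObsRule n T) {ε : ℝ} (hε : 0 ≤ ε)
    (hT : -ε ≤ gain ν v (gittinsIndex ν v n) T) :
    gittinsIndex ν v n - ν - n ^ 2 * ε ≤
      (n - 1) * ∫ ω in {ω | T (rewards ω) = n}, (ω.1 - gittinsIndex ν v n) ∂(armLaw ν v) := by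
  have hn : 1 ≤ n := (h.one_le 0).trans (h.le 0)
  have hn1 : (1 : ℝ) ≤ n := mod_cast hn
  have hsum := h.gain_eq_sum (ν := ν) (v := v) (gittinsIndex ν v n)
  rw [← Finset.sum_Ico_add_eq_sum_Icc hn] at hsum
  have hle : ∑ t ∈ Finset.Ico 1 n, ((t : ℝ) - 1) *
      ∫ ω in {ω | T (rewards ω) = t}, (ω.1 - gittinsIndex ν v n) ∂(armLaw ν v) ≤
        ((n - 1 : ℕ) : ℝ) * ((n - 1) * ε) := by
    rw [← nsmul_eq_mul, ← Nat.card_Ico]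
    refine Finset.sum_le_card_nsmul _ _ _ fun t ht => ?_
    obtain ⟨h1t, htn⟩ := Finset.mem_Ico.1 ht
    have h1t' : (1 : ℝ) ≤ t := mod_cast h1t
    have htn' : (t : ℝ) ≤ n := mod_cast htn.le
    have hbε := (h.setIntegral_sub_gittinsIndex_le (ν := ν) (v := v) htn).trans (neg_le.1 hT)
    exact (mul_le_mul_of_nonneg_left hbε (by linarith)).trans
      (mul_le_mul_of_nonneg_right (by linarith) hε)
  rw [Nat.cast_pred hn] at hle
  nlinarith

end Horizon

theorem sq_setIntegral_le {Ω : Type*} [MeasurableSpace Ω] {P : Measure Ω} [IsFiniteMeasure P]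
    {f : Ω → ℝ} (hf : MemLp f 2 P) {A : Set Ω} (hA : MeasurableSet A) :
    (∫ ω in A, f ω ∂P) ^ 2 ≤ P.real A * ∫ ω, f ω ^ 2 ∂P := by
  have hcoe := hf.coeFn_toLp
  have h := real_inner_mul_inner_self_le (indicatorConstLp 2 hA (measure_ne_top P A) (1 : ℝ))
    (hf.toLp f)
  rw [L2.inner_indicatorConstLp_one, L2.real_inner_indicatorConstLp_one_indicatorConstLp_one hA hA,
    L2.inner_def, Set.inter_self, setIntegral_congr_ae hA (hcoe.mono fun _ hω _ => hω)] at h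
  calc (∫ ω in A, f ω ∂P) ^ 2 ≤ P.real A * ∫ ω, inner ℝ (hf.toLp f ω) (hf.toLp f ω) ∂P := by
        rwa [sq]
    _ = P.real A * ∫ ω, f ω ^ 2 ∂P := by
        congr 1
        refine integral_congr_ae (hcoe.mono fun ω hω => ?_)
        simp only [hω, real_inner_self_eq_norm_sq, Real.norm_eq_abs, sq_abs]

theorem indepFun_sub_sum_mul_of_covariance_eq_zero {Ω ι : Type*} [MeasurableSpace Ω] [Fintype ι]
    {P : Measure Ω} {X : Ω → ℝ} {Y : ι → Ω → ℝ} (a : ι → ℝ)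
    (hXY : HasGaussianLaw (fun ω => (X ω, fun i => Y i ω)) P)
    (h : ∀ j, cov[fun ω => X ω - ∑ i, a i * Y i ω, Y j; P] = 0) :
    IndepFun (fun ω => X ω - ∑ i, a i * Y i ω) (fun ω i => Y i ω) P := by
  let L : ℝ × (ι → ℝ) →L[ℝ] (Unit → ℝ) × (ι → ℝ) :=
    (ContinuousLinearMap.pi fun _ => .fst ℝ ℝ (ι → ℝ) -
      (∑ i, a i • .proj i) ∘L .snd ℝ ℝ (ι → ℝ)).prod (.snd ℝ ℝ (ι → ℝ))
  have hL : ∀ ω, L (X ω, fun i => Y i ω) =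
      (fun _ => X ω - ∑ i, a i * Y i ω, fun i => Y i ω) := fun ω => by
    ext <;> simp [L]
  have hlaw := hXY.map_fun L
  simp only [hL] at hlaw
  exact (hlaw.indepFun_of_covariance_eval (X := fun _ ω => X ω - ∑ i, a i * Y i ω)
    fun _ => h).comp (measurable_pi_apply ()) measurable_id

section GaussianArm

variable (ν : ℝ) (v : ℝ≥0)

theorem hasLaw_fst_armLaw : HasLaw (fun ω => ω.1) (gaussianReal ν v) (armLaw ν v) :=
  measurePreserving_fst.hasLaw

theorem hasLaw_noise_armLaw (s : ℕ) :
    HasLaw (fun ω => ω.2 s) (gaussianReal 0 1) (armLaw ν v) :=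
  ((measurePreserving_eval_infinitePi (fun _ : ℕ => gaussianReal 0 1) s).comp
    measurePreserving_snd).hasLaw

theorem indepFun_fst_noise_armLaw :
    IndepFun (fun ω => ω.1) (fun ω => ω.2) (armLaw ν v) :=
  indepFun_prod (X := id) (Y := id) measurable_id measurable_id

theorem iIndepFun_noise_armLaw : iIndepFun (fun s ω => ω.2 s) (armLaw ν v) := by
  rw [iIndepFun_iff_map_fun_eq_infinitePi_map (by fun_prop)]
  simp only [(hasLaw_noise_armLaw ν v _).map_eq]
  exact measurePreserving_snd.map_eq

theorem memLp_fst_armLaw : MemLp (fun ω => ω.1) 2 (armLaw ν v) :=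
  (hasLaw_fst_armLaw ν v).hasGaussianLaw.memLp_two

theorem memLp_noise_armLaw (s : ℕ) : MemLp (fun ω => ω.2 s) 2 (armLaw ν v) :=
  (hasLaw_noise_armLaw ν v s).hasGaussianLaw.memLp_two

theorem memLp_rewards_armLaw (s : ℕ) : MemLp (fun ω => rewards ω s) 2 (armLaw ν v) :=
  (memLp_fst_armLaw ν v).add (memLp_noise_armLaw ν v s)

theorem hasLaw_rewards_armLaw (s : ℕ) :
    HasLaw (fun ω => rewards ω s) (gaussianReal ν (v + 1)) (armLaw ν v) := by
  have h := gaussianReal_add_gaussianReal_of_indepFun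
    ((indepFun_fst_noise_armLaw ν v).comp measurable_id (measurable_pi_apply s))
    (hasLaw_fst_armLaw ν v).map_eq (hasLaw_noise_armLaw ν v s).map_eq
  rw [add_zero] at h
  exact ⟨by fun_prop, h⟩

theorem hasGaussianLaw_fst_obs (k : ℕ) :
    HasGaussianLaw (fun ω => (ω.1, obs k ω)) (armLaw ν v) := by
  have hnoise : HasGaussianLaw (fun ω (s : Fin k) => ω.2 s) (armLaw ν v) :=
    ((iIndepFun_noise_armLaw ν v).precomp Fin.val_injective).hasGaussianLaw
      fun s => (hasLaw_noise_armLaw ν v s).hasGaussianLaw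
  have hindep : IndepFun (fun ω => ω.1) (fun ω (s : Fin k) => ω.2 s) (armLaw ν v) :=
    (indepFun_fst_noise_armLaw ν v).comp measurable_id
      (measurable_pi_lambda _ fun s : Fin k => measurable_pi_apply (s : ℕ))
  exact (hindep.hasGaussianLaw (hasLaw_fst_armLaw ν v).hasGaussianLaw hnoise).map_fun
    ((ContinuousLinearMap.fst ℝ ℝ (Fin k → ℝ)).prod
      (.pi fun s => .fst ℝ ℝ (Fin k → ℝ) + .proj s ∘L .snd ℝ ℝ (Fin k → ℝ)))

theorem covariance_fst_rewards (s : ℕ) :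
    cov[fun ω => ω.1, fun ω => rewards ω s; armLaw ν v] = v := by
  have hfst := memLp_fst_armLaw ν v
  have hnoise := memLp_noise_armLaw ν v s
  have hself : cov[fun ω => ω.1, fun ω => ω.1; armLaw ν v] = v := by
    rw [covariance_self (by fun_prop), (hasLaw_fst_armLaw ν v).variance_eq,
      variance_id_gaussianReal]
  have hindep : cov[fun ω => ω.1, fun ω => ω.2 s; armLaw ν v] = 0 :=
    ((indepFun_fst_noise_armLaw ν v).comp measurable_id
      (measurable_pi_apply s)).covariance_eq_zero hfst hnoise
  calc cov[fun ω => ω.1, (fun ω => ω.1) + fun ω => ω.2 s; armLaw ν v] = v + 0 := by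
        rw [covariance_add_right hfst hfst hnoise, hself, hindep]
    _ = v := add_zero _

theorem covariance_noise_rewards (s j : ℕ) :
    cov[fun ω => ω.2 s, fun ω => rewards ω j; armLaw ν v] = if s = j then 1 else 0 := by
  have hfst := memLp_fst_armLaw ν v
  have hnoise := memLp_noise_armLaw ν v
  have hindep : cov[fun ω => ω.2 s, fun ω => ω.1; armLaw ν v] = 0 :=
    ((indepFun_fst_noise_armLaw ν v).symm.comp (measurable_pi_apply s)
      measurable_id).covariance_eq_zero (hnoise s) hfst
  have hself : cov[fun ω => ω.2 s, fun ω => ω.2 j; armLaw ν v] = if s = j then 1 else 0 := by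
    split_ifs with hsj
    · rw [← hsj, covariance_self (by fun_prop), (hasLaw_noise_armLaw ν v s).variance_eq,
        variance_id_gaussianReal, NNReal.coe_one]
    · exact ((iIndepFun_noise_armLaw ν v).indepFun hsj).covariance_eq_zero (hnoise s) (hnoise j)
  calc cov[fun ω => ω.2 s, (fun ω => ω.1) + fun ω => ω.2 j; armLaw ν v]
      = 0 + if s = j then 1 else 0 := by
        rw [covariance_add_right (hnoise s) hfst (hnoise j), hself, hindep]
    _ = if s = j then 1 else 0 := zero_add _

theorem covariance_rewards_rewards (s j : ℕ) :
    cov[fun ω => rewards ω s, fun ω => rewards ω j; armLaw ν v] = v + if s = j then 1 else 0 := by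
  rw [← covariance_fst_rewards ν v j, ← covariance_noise_rewards ν v s j]
  exact covariance_add_left (memLp_fst_armLaw ν v) (memLp_noise_armLaw ν v s)
    (memLp_rewards_armLaw ν v j)

/-- The mean of the law of `μ ∼ N(ν, v)` given `k` observations `y s ∼ N(μ, 1)`, as a correction of
the prior mean `ν`. -/
def posteriorMean (ν : ℝ) (v : ℝ≥0) (k : ℕ) (y : ℕ → ℝ) : ℝ :=
  ν + v / (1 + k * v) * ∑ s : Fin k, (y s - ν)

theorem integral_posteriorMean_sub (k : ℕ) :
    ∫ ω, (posteriorMean ν v k (rewards ω) - ν) ∂(armLaw ν v) = 0 := by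
  have hrewards (s : ℕ) : ∫ ω, (rewards ω s - ν) ∂(armLaw ν v) = 0 := by
    rw [integral_sub ((memLp_rewards_armLaw ν v s).integrable one_le_two) (integrable_const ν),
      (hasLaw_rewards_armLaw ν v s).integral_eq, integral_id_gaussianReal, integral_const,
      probReal_univ, one_smul, sub_self]
  have hint (s : ℕ) : Integrable (fun ω => rewards ω s - ν) (armLaw ν v) :=
    ((memLp_rewards_armLaw ν v s).integrable one_le_two).sub (integrable_const ν)
  simp only [posteriorMean, add_sub_cancel_left]
  rw [integral_const_mul, integral_finsetSum _ fun (s : Fin k) _ => hint s]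
  simp only [hrewards, Finset.sum_const_zero, mul_zero]

theorem posteriorMean_eq_add_sum_mul (k : ℕ) (y : ℕ → ℝ) :
    posteriorMean ν v k y = ν - v / (1 + k * v) * (k * ν) + ∑ s : Fin k, v / (1 + k * v) * y s := by
  rw [posteriorMean, Finset.sum_sub_distrib, Fin.sum_const, ← Finset.mul_sum, nsmul_eq_mul]
  ring

theorem covariance_posteriorMean_right {X : ℝ × (ℕ → ℝ) → ℝ} (hX : MemLp X 2 (armLaw ν v))
    (k : ℕ) : cov[X, fun ω => posteriorMean ν v k (rewards ω); armLaw ν v] =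
      v / (1 + k * v) * ∑ s : Fin k, cov[X, fun ω => rewards ω s; armLaw ν v] := by
  have hmem (s : ℕ) : MemLp (fun ω => v / (1 + k * v) * rewards ω s) 2 (armLaw ν v) :=
    (memLp_rewards_armLaw ν v s).const_mul _
  simp only [posteriorMean_eq_add_sum_mul]
  rw [covariance_const_add_right
      ((memLp_finsetSum _ fun (s : Fin k) _ => hmem s).integrable one_le_two),
    covariance_fun_sum_right (fun s : Fin k => hmem s) hX]
  simp only [covariance_const_mul_right, Finset.mul_sum]

theorem covariance_rewards_posteriorMean {k j : ℕ} (hj : j < k) :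
    cov[fun ω => rewards ω j, fun ω => posteriorMean ν v k (rewards ω); armLaw ν v] = v := by
  have hkv : 1 + k * (v : ℝ) ≠ 0 := by positivity
  have hsum : ∑ s : Fin k, cov[fun ω => rewards ω j, fun ω => rewards ω s; armLaw ν v] =
      1 + k * v := by
    simp only [covariance_rewards_rewards, Finset.sum_add_distrib, Fin.sum_const, nsmul_eq_mul]
    rw [Finset.sum_eq_single ⟨j, hj⟩ (by grind) (by simp), if_pos rfl, add_comm]
  rw [covariance_posteriorMean_right ν v (memLp_rewards_armLaw ν v j), hsum,
    div_mul_cancel₀ _ hkv]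

theorem memLp_posteriorMean (k : ℕ) :
    MemLp (fun ω => posteriorMean ν v k (rewards ω)) 2 (armLaw ν v) :=
  (memLp_const ν).add ((memLp_finsetSum _ fun (s : Fin k) _ =>
    (memLp_rewards_armLaw ν v s).sub (memLp_const ν)).const_mul _)

theorem variance_posteriorMean (k : ℕ) :
    Var[fun ω => posteriorMean ν v k (rewards ω); armLaw ν v] = k * v ^ 2 / (1 + k * v) := by
  rw [← covariance_self (memLp_posteriorMean ν v k).aemeasurable,
    covariance_posteriorMean_right ν v (memLp_posteriorMean ν v k)]
  simp only [covariance_comm (fun ω => posteriorMean ν v k (rewards ω)),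
    covariance_rewards_posteriorMean ν v (Fin.is_lt _), Fin.sum_const, nsmul_eq_mul]
  ring

theorem indepFun_fst_sub_posteriorMean_obs (k : ℕ) :
    IndepFun (fun ω => ω.1 - posteriorMean ν v k (rewards ω)) (obs k) (armLaw ν v) := by
  have hresidual : ∀ ω : ℝ × (ℕ → ℝ), ω.1 - posteriorMean ν v k (rewards ω) =
      (ω.1 - ∑ s : Fin k, v / (1 + k * v) * rewards ω s) -
        (ν - v / (1 + k * v) * (k * ν)) := fun ω => by
    rw [posteriorMean_eq_add_sum_mul]; ring
  have hmem : MemLp (fun ω => ∑ s : Fin k, v / (1 + k * v) * rewards ω s) 2 (armLaw ν v) :=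
    memLp_finsetSum _ fun (s : Fin k) _ => (memLp_rewards_armLaw ν v s).const_mul _
  have hindep := indepFun_sub_sum_mul_of_covariance_eq_zero (Y := fun s : Fin k => (rewards · s))
    (fun _ => v / (1 + k * v)) (hasGaussianLaw_fst_obs ν v k) fun j => by
      rw [covariance_fun_sub_left (memLp_fst_armLaw ν v) hmem (memLp_rewards_armLaw ν v j),
        covariance_fst_rewards, sub_eq_zero]
      conv_lhs => rw [← covariance_rewards_posteriorMean ν v j.2]
      simp only [posteriorMean_eq_add_sum_mul]
      rw [covariance_const_add_right (hmem.integrable one_le_two), covariance_comm]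
  simp only [hresidual]
  exact hindep.comp (measurable_id.sub_const _) measurable_id

theorem setIntegral_fst_sub_posteriorMean {k : ℕ} {A : Set (ℝ × (ℕ → ℝ))}
    (hA : MeasurableSet[.comap (obs k) inferInstance] A) :
    ∫ ω in A, (ω.1 - posteriorMean ν v k (rewards ω)) ∂(armLaw ν v) = 0 := by
  have hfst := (memLp_fst_armLaw ν v).integrable one_le_two
  have hpost := (memLp_posteriorMean ν v k).integrable one_le_two
  have hmean : ∫ ω, (ω.1 - posteriorMean ν v k (rewards ω)) ∂(armLaw ν v) = 0 := by
    have h := integral_posteriorMean_sub ν v k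
    rw [integral_sub hpost (integrable_const ν), integral_const, probReal_univ, one_smul,
      sub_eq_zero] at h
    rw [integral_sub hfst hpost, integral_fst_armLaw, h, sub_self]
  have hindep := (indepFun_fst_sub_posteriorMean_obs ν v k).symm
  have h := Indep.setIntegral_eq_mul (measurable_obs k).comap_le (f := id) hindep
    (hfst.sub hpost).aemeasurable hA aestronglyMeasurable_id
  simpa only [id, hmean, mul_zero] using h

theorem setIntegral_fst_sub {k : ℕ} {A : Set (ℝ × (ℕ → ℝ))}
    (hA : MeasurableSet[.comap (obs k) inferInstance] A) (c : ℝ) :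
    ∫ ω in A, (ω.1 - c) ∂(armLaw ν v) =
      ∫ ω in A, (posteriorMean ν v k (rewards ω) - c) ∂(armLaw ν v) := by
  have hfst := (memLp_fst_armLaw ν v).integrable one_le_two
  have hpost := (memLp_posteriorMean ν v k).integrable one_le_two
  have h := setIntegral_fst_sub_posteriorMean ν v hA
  rw [integral_sub hfst.integrableOn hpost.integrableOn, sub_eq_zero] at h
  rw [integral_sub hfst.integrableOn (integrable_const c),
    integral_sub hpost.integrableOn (integrable_const c), h]

theorem sq_setIntegral_fst_sub_le {k : ℕ} {A : Set (ℝ × (ℕ → ℝ))}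
    (hA : MeasurableSet[.comap (obs k) inferInstance] A) :
    (∫ ω in A, (ω.1 - ν) ∂(armLaw ν v)) ^ 2 ≤
      (armLaw ν v).real A * (k * v ^ 2 / (1 + k * v)) := by
  have hpost := memLp_posteriorMean ν v k
  have hmean : ∫ ω, posteriorMean ν v k (rewards ω) ∂(armLaw ν v) = ν := by
    have h := integral_posteriorMean_sub ν v k
    rwa [integral_sub (hpost.integrable one_le_two) (integrable_const ν), integral_const,
      probReal_univ, one_smul, sub_eq_zero] at h
  rw [setIntegral_fst_sub ν v hA, ← variance_posteriorMean, variance_eq_integral hpost.aemeasurable,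
    hmean]
  exact sq_setIntegral_le (hpost.sub (memLp_const ν)) ((measurable_obs k).comap_le _ hA)

end GaussianArm

/-- The mean of the positive part of a standard Gaussian variable. -/
def gaussianPosPart : ℝ := ∫ x, max x 0 ∂(gaussianReal 0 1)

theorem gaussianPosPart_pos : 0 < gaussianPosPart := by
  have hint : Integrable (fun x : ℝ => max x 0) (gaussianReal 0 1) :=
    ((memLp_id_gaussianReal 1).integrable le_rfl).pos_part
  have hsupp : Function.support (fun x : ℝ => max x 0) = Set.Ioi 0 := by
    ext x
    simp
  have hpos : gaussianReal 0 1 (Set.Ioi 0) ≠ 0 := fun h => by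
    simpa using gaussianReal_absolutelyContinuous' 0 one_ne_zero h
  exact (integral_pos_iff_support_of_nonneg (fun _ => le_max_right _ _) hint).2
    (hsupp ▸ pos_iff_ne_zero.2 hpos)

theorem map_standardGaussian (ν : ℝ) (v : ℝ≥0) :
    (gaussianReal 0 1).map (fun x => √v * x + ν) = gaussianReal ν v := by
  rw [← Function.comp_def (· + ν) (√v * ·), ← Measure.map_map (by fun_prop) (by fun_prop),
    gaussianReal_map_const_mul, gaussianReal_map_add_const, mul_zero, zero_add, mul_one]
  congr 1
  exact NNReal.eq (Real.sq_sqrt v.2)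

theorem integral_max_sub_gaussianReal (ν : ℝ) (v : ℝ≥0) :
    ∫ x, max (x - ν) 0 ∂(gaussianReal ν v) = √v * gaussianPosPart := by
  rw [← map_standardGaussian, integral_map (by fun_prop) (by fun_prop), gaussianPosPart,
    ← integral_const_mul]
  refine integral_congr_ae (.of_forall fun x => ?_)
  simp only [add_sub_cancel_right, mul_max_of_nonneg _ _ (Real.sqrt_nonneg _), mul_zero]

/-- After one observation, the posterior mean exceeds `ν` exactly when the observation does. -/
theorem setIntegral_fst_sub_first_obs (ν : ℝ) (v : ℝ≥0) :
    ∫ ω in {ω | ν ≤ rewards ω 0}, (ω.1 - ν) ∂(armLaw ν v) =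
      v / (1 + v) * (√(v + 1) * gaussianPosPart) := by
  have hA : MeasurableSet[.comap (obs 1) inferInstance] {ω | ν ≤ rewards ω 0} :=
    measurableSet_comap_obs (measurableSet_le measurable_const (measurable_pi_apply 0))
      fun y y' hy h => (hy 0 one_pos).subst h
  have hmax : ∀ y : ℝ, (Set.Ici ν).indicator (fun y => y - ν) y = max (y - ν) 0 := fun y => by
    grind [Set.indicator_apply]
  calc ∫ ω in {ω | ν ≤ rewards ω 0}, (ω.1 - ν) ∂(armLaw ν v)
      = ∫ ω in {ω | ν ≤ rewards ω 0}, v / (1 + v) * (rewards ω 0 - ν) ∂(armLaw ν v) := by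
        rw [setIntegral_fst_sub ν v hA]
        simp [posteriorMean]
    _ = v / (1 + v) * ∫ ω, max (rewards ω 0 - ν) 0 ∂(armLaw ν v) := by
        rw [integral_const_mul, ← integral_indicator ((measurable_obs 1).comap_le _ hA)]
        simp only [← hmax]
        rfl
    _ = v / (1 + v) * (√(v + 1) * gaussianPosPart) := by
        have hsqrt : √((v : ℝ) + 1) = √((v + 1 : ℝ≥0) : ℝ) := by
          rw [NNReal.coe_add, NNReal.coe_one]
        rw [hsqrt, ← integral_max_sub_gaussianReal ν, ← (hasLaw_rewards_armLaw ν v 0).map_eq,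
          integral_map (by fun_prop) (by fun_prop)]

theorem IsObsRule.gain_le_mul_gittinsIndex_sub {ν : ℝ} {v : ℝ≥0} {n : ℕ} {T : (ℕ → ℝ) → ℕ}
    (h : IsObsRule n T) : gain ν v ν T ≤ n * (gittinsIndex ν v n - ν) := by
  have hn : 1 ≤ n := (h.one_le 0).trans (h.le 0)
  linarith [gain_sub_mul_le (ν := ν) (v := v) (le_gittinsIndex ν v hn) h.measurable h.le,
    h.gain_gittinsIndex_nonpos (ν := ν) (v := v)]

theorem gain_ite (ν : ℝ) (v : ℝ≥0) (n : ℕ) {S : Set (ℕ → ℝ)} [DecidablePred (· ∈ S)]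
    (hS : MeasurableSet S) :
    gain ν v ν (fun y => if y ∈ S then n else 1) =
      (n - 1) * ∫ ω in rewards ⁻¹' S, (ω.1 - ν) ∂(armLaw ν v) := by
  have hA : MeasurableSet (rewards ⁻¹' S) := measurable_rewards hS
  have hsub : Integrable (fun ω => ω.1 - ν) (armLaw ν v) :=
    (integrable_fst_armLaw ν v).sub (integrable_const ν)
  have hsplit : ∀ ω : ℝ × (ℕ → ℝ), (ω.1 - ν) * ((if rewards ω ∈ S then n else 1 : ℕ) : ℝ) =
      (ω.1 - ν) + (n - 1) * (rewards ⁻¹' S).indicator (fun ω => ω.1 - ν) ω := fun ω => by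
    by_cases hω : rewards ω ∈ S
    · rw [if_pos hω, Set.indicator_of_mem (Set.mem_preimage.2 hω)]
      ring
    · rw [if_neg hω, Set.indicator_of_notMem (Set.mem_preimage.not.2 hω), Nat.cast_one]
      ring
  simp only [gain, hsplit]
  rw [integral_add hsub ((hsub.indicator hA).const_mul _), integral_const_mul,
    integral_indicator hA, integral_sub (integrable_fst_armLaw ν v) (integrable_const ν),
    integral_fst_armLaw, integral_const, probReal_univ, one_smul, sub_self, zero_add]

/-- The right-hand side bounds the gain of the rule that continues until the horizon if the first
observation is at least `ν` and stops after it otherwise. -/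
theorem le_mul_gittinsIndex_sub (ν : ℝ) (v : ℝ≥0) {n : ℕ} (hn : 1 ≤ n) :
    (n - 1) * (v / (1 + v) * (√(v + 1) * gaussianPosPart)) ≤ n * (gittinsIndex ν v n - ν) := by
  classical
  have hS : MeasurableSet {y : ℕ → ℝ | ν ≤ y 0} :=
    measurableSet_le measurable_const (measurable_pi_apply 0)
  have hT : IsObsRule n fun y => if y ∈ {y : ℕ → ℝ | ν ≤ y 0} then n else 1 :=
    { measurable := .ite hS measurable_const measurable_const
      nonAnticipating := fun y y' hy => by
        have h0 : y 0 = y' 0 := hy 0 (by grind)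
        simp only [Set.mem_ofPred_eq, h0]
      one_le := fun y => by grind
      le := fun y => by grind }
  rw [← setIntegral_fst_sub_first_obs]
  exact (gain_ite ν v n hS).symm.trans_le hT.gain_le_mul_gittinsIndex_sub

section HorizonProbability

variable {ν : ℝ} {v : ℝ≥0} {n : ℕ} {T : (ℕ → ℝ) → ℕ}

theorem IsObsRule.sq_setIntegral_sub_le (h : IsObsRule n T) :
    (∫ ω in {ω | T (rewards ω) = n}, (ω.1 - ν) ∂(armLaw ν v)) ^ 2 ≤
      (armLaw ν v).real {ω | T (rewards ω) = n} * (n * (v ^ 2 / (1 + v))) := by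
  have hn : 1 ≤ n := (h.one_le 0).trans (h.le 0)
  have hn1 : (1 : ℝ) ≤ n := mod_cast hn
  refine (sq_setIntegral_fst_sub_le ν v h.measurableSet_eq_horizon).trans
    (mul_le_mul_of_nonneg_left ?_ measureReal_nonneg)
  have hnv : 0 ≤ ((n : ℝ) - 1) * v := mul_nonneg (by linarith) v.2
  rw [Nat.cast_pred hn, ← mul_div_assoc, div_le_div_iff₀ (by linarith) (by positivity)]
  have hcross : ((n : ℝ) - 1) * (1 + v) ≤ n * (1 + (n - 1) * v) := by nlinarith
  nlinarith [mul_le_mul_of_nonneg_right hcross (sq_nonneg (v : ℝ))]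

theorem IsObsRule.half_gittinsIndex_sub_le (h : IsObsRule n T) (hG : ν ≤ gittinsIndex ν v n)
    (hT : -((gittinsIndex ν v n - ν) / (2 * n ^ 2)) ≤ gain ν v (gittinsIndex ν v n) T) :
    (gittinsIndex ν v n - ν) / 2 ≤
      (n - 1) * ∫ ω in {ω | T (rewards ω) = n}, (ω.1 - ν) ∂(armLaw ν v) := by
  have hn : 1 ≤ n := (h.one_le 0).trans (h.le 0)
  have hn1 : (1 : ℝ) ≤ n := mod_cast hn
  set G := gittinsIndex ν v n
  have hfst := integrable_fst_armLaw ν v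
  have hmono : ∫ ω in {ω | T (rewards ω) = n}, (ω.1 - G) ∂(armLaw ν v) ≤
      ∫ ω in {ω | T (rewards ω) = n}, (ω.1 - ν) ∂(armLaw ν v) :=
    setIntegral_mono (hfst.sub (integrable_const G)).integrableOn
      (hfst.sub (integrable_const ν)).integrableOn fun ω => sub_le_sub_left hG _
  have hδ : 0 ≤ (G - ν) / (2 * n ^ 2) := div_nonneg (sub_nonneg.2 hG) (by positivity)
  calc (G - ν) / 2 = G - ν - n ^ 2 * ((G - ν) / (2 * n ^ 2)) := by field_simp; ring
    _ ≤ (n - 1) * ∫ ω in {ω | T (rewards ω) = n}, (ω.1 - G) ∂(armLaw ν v) :=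
        h.gittinsIndex_sub_le hδ hT
    _ ≤ _ := mul_le_mul_of_nonneg_left hmono (by linarith)

/-- The integral of `μ - ν` over `{T = n}` is at least of order `v / (√(1 + v) n)` by the lower
bound on the index, whereas its square is at most of order `v ^ 2 n / (1 + v)` times the
probability of that event. -/
theorem IsObsRule.le_prob_horizon (h : IsObsRule n T) (hG : ν < gittinsIndex ν v n)
    (hT : -((gittinsIndex ν v n - ν) / (2 * n ^ 2)) ≤ gain ν v (gittinsIndex ν v n) T) :
    gaussianPosPart ^ 2 / 4 / n ^ 3 ≤ (armLaw ν v).real {ω | T (rewards ω) = n} := by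
  have hn : 1 ≤ n := (h.one_le 0).trans (h.le 0)
  have hn1 : (1 : ℝ) ≤ n := mod_cast hn
  have hhalf := h.half_gittinsIndex_sub_le hG.le hT
  have hindex := le_mul_gittinsIndex_sub ν v hn
  have hsq := h.sq_setIntegral_sub_le (ν := ν) (v := v)
  set x := ∫ ω in {ω | T (rewards ω) = n}, (ω.1 - ν) ∂(armLaw ν v)
  set p := (armLaw ν v).real {ω | T (rewards ω) = n}
  set w := v / (1 + v) * (√(v + 1) * gaussianPosPart)
  have hprod : 0 < (n - 1) * x := (half_pos (sub_pos.2 hG)).trans_le hhalf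
  have hn2 : (0 : ℝ) < n - 1 := lt_of_le_of_ne (by linarith) (left_ne_zero_of_mul hprod.ne').symm
  have hx : 0 < x := pos_of_mul_pos_right hprod hn2.le
  have hw0 : 0 ≤ w := by positivity [gaussianPosPart_pos]
  have hwx : w ≤ 2 * n * x := le_of_mul_le_mul_left (by nlinarith) hn2
  have hwsq : w ^ 2 = gaussianPosPart ^ 2 * (v ^ 2 / (1 + v)) := by
    simp only [w, mul_pow, Real.sq_sqrt (by positivity : (0 : ℝ) ≤ v + 1)]
    field_simp
    ring
  have hv : 0 < (v : ℝ) ^ 2 / (1 + v) :=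
    (by positivity : (0 : ℝ) ≤ v ^ 2 / (1 + v)).lt_of_ne fun h0 => by
      rw [← h0, mul_zero, mul_zero] at hsq
      exact hsq.not_gt (pow_pos hx 2)
  rw [div_div, div_le_iff₀ (by positivity)]
  refine le_of_mul_le_mul_right ?_ hv
  calc gaussianPosPart ^ 2 * (v ^ 2 / (1 + v)) = w ^ 2 := hwsq.symm
    _ ≤ (2 * n * x) ^ 2 := pow_le_pow_left₀ hw0 hwx 2
    _ = 4 * n ^ 2 * x ^ 2 := by ring
    _ ≤ 4 * n ^ 2 * (p * (n * (v ^ 2 / (1 + v)))) := by gcongr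
    _ = p * (4 * n ^ 3) * (v ^ 2 / (1 + v)) := by ring

theorem exists_isObsRule_le_prob_horizon (ν : ℝ) (v : ℝ≥0) (hn : 1 ≤ n) {ε : ℝ} (hε : 0 < ε) :
    ∃ T, IsObsRule n T ∧ -ε < gain ν v (gittinsIndex ν v n) T ∧
      min (gaussianPosPart ^ 2 / 4) 1 / n ^ 3 ≤ (armLaw ν v).real {ω | T (rewards ω) = n} := by
  have hn1 : (1 : ℝ) ≤ n := mod_cast hn
  rcases (le_gittinsIndex ν v hn).eq_or_lt with hG | hG
  · refine ⟨_, isObsRule_const hn le_rfl, ?_, ?_⟩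
    · rwa [gain_const, ← hG, sub_self, zero_mul, neg_lt_zero]
    · simp only [Set.ofPred_true, probReal_univ]
      exact (div_le_one (by positivity)).2 ((min_le_right _ _).trans (one_le_pow₀ hn1))
  · have hδ : 0 < (gittinsIndex ν v n - ν) / (2 * n ^ 2) := by
      have := sub_pos.2 hG
      positivity
    obtain ⟨T, hT, hgain⟩ := exists_isObsRule_neg_lt_gain ν v hn (lt_min hε hδ)
    refine ⟨T, hT, (neg_le_neg (min_le_left _ _)).trans_lt hgain, ?_⟩
    refine (div_le_div_of_nonneg_right (min_le_left _ _) (by positivity)).trans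
      (hT.le_prob_horizon hG ?_)
    exact (neg_le_neg (min_le_right _ _)).trans hgain.le

end HorizonProbability

section FirstRound

variable {n : ℕ} {T N : (ℕ → ℝ) → ℕ}

theorem le_sub_mul_natSub {s t : ℕ} (ht : t ≤ n) (hs : s < n) (m G x : ℝ) :
    (m - G) * t - (m - G) * (min t s : ℕ) + (if t = n then G - x else 0) -
      (n - 1) * max (x - G) 0 ≤ (m - x) * (t - s : ℕ) := by
  have hsplit : (t : ℝ) = (t - s : ℕ) + (min t s : ℕ) := mod_cast (by omega)
  suffices h : (if t = n then G - x else 0) - (n - 1) * max (x - G) 0 ≤ (G - x) * (t - s : ℕ) by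
    rw [hsplit]
    linarith
  rcases le_total x G with hx | hx
  · have hlower : (if t = n then 1 else 0) ≤ ((t - s : ℕ) : ℝ) := mod_cast (by grind)
    rw [max_eq_right (sub_nonpos.2 hx)]
    have := mul_le_mul_of_nonneg_left hlower (sub_nonneg.2 hx)
    split_ifs at * <;> linarith
  · have hupper : ((t - s : ℕ) : ℝ) + 1 ≤ n + (if t = n then 1 else 0) := mod_cast (by grind)
    rw [max_eq_left (sub_nonneg.2 hx)]
    have := mul_le_mul_of_nonneg_left hupper (sub_nonneg.2 hx)
    split_ifs at * <;> linarith

theorem IsObsRule.le_integral_sub_mul {ν : ℝ} {v : ℝ≥0} (hT : IsObsRule n T)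
    (hN : NonAnticipating N) (hNm : Measurable N) (hNn : ∀ y, N y < n) (x : ℝ) :
    gain ν v (gittinsIndex ν v n) T +
        (gittinsIndex ν v n - x) * (armLaw ν v).real {ω | T (rewards ω) = n} -
        (n - 1) * max (x - gittinsIndex ν v n) 0 ≤
      ∫ ω, (ω.1 - x) * ((T (rewards ω) - N (rewards ω) : ℕ) : ℝ) ∂(armLaw ν v) := by
  set G := gittinsIndex ν v n
  have hTm := hT.measurable
  have hE := hT.measurableSet_eq n
  have hmin : gain ν v G (fun y => min (T y) (N y)) ≤ 0 :=
    (hT.nonAnticipating.min hN).gain_gittinsIndex_nonpos (by fun_prop)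
      fun y => (min_le_left _ _).trans (hT.le y)
  have hintT : Integrable (fun ω => (ω.1 - G) * (T (rewards ω) : ℝ)) (armLaw ν v) :=
    integrable_sub_mul G (by fun_prop) fun ω => hT.le _
  have hintmin : Integrable (fun ω => (ω.1 - G) * ((min (T (rewards ω)) (N (rewards ω)) : ℕ) : ℝ))
      (armLaw ν v) :=
    integrable_sub_mul G (by fun_prop) fun ω => (min_le_left _ _).trans (hT.le _)
  have hintE : Integrable ({ω | T (rewards ω) = n}.indicator fun _ => G - x) (armLaw ν v) :=
    (integrable_const _).indicator hE
  have hintTmin : Integrable (fun ω => (ω.1 - G) * (T (rewards ω) : ℝ) -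
      (ω.1 - G) * ((min (T (rewards ω)) (N (rewards ω)) : ℕ) : ℝ)) (armLaw ν v) :=
    hintT.sub hintmin
  have hintsum : Integrable (fun ω => (ω.1 - G) * (T (rewards ω) : ℝ) -
      (ω.1 - G) * ((min (T (rewards ω)) (N (rewards ω)) : ℕ) : ℝ) +
      {ω | T (rewards ω) = n}.indicator (fun _ => G - x) ω) (armLaw ν v) := hintTmin.add hintE
  calc gain ν v G T + (G - x) * (armLaw ν v).real {ω | T (rewards ω) = n} -
        (n - 1) * max (x - G) 0
      ≤ gain ν v G T - gain ν v G (fun y => min (T y) (N y)) +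
          (armLaw ν v).real {ω | T (rewards ω) = n} * (G - x) - (n - 1) * max (x - G) 0 := by
        linarith
    _ = ∫ ω, ((ω.1 - G) * (T (rewards ω) : ℝ) -
          (ω.1 - G) * ((min (T (rewards ω)) (N (rewards ω)) : ℕ) : ℝ) +
          {ω | T (rewards ω) = n}.indicator (fun _ => G - x) ω - (n - 1) * max (x - G) 0)
          ∂(armLaw ν v) := by
        rw [integral_sub hintsum (integrable_const _), integral_add hintTmin hintE,
          integral_sub hintT hintmin, integral_const, integral_indicator_const _ hE,
          probReal_univ, one_smul, smul_eq_mul, gain, gain]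
    _ ≤ ∫ ω, (ω.1 - x) * ((T (rewards ω) - N (rewards ω) : ℕ) : ℝ) ∂(armLaw ν v) :=
        integral_mono (hintsum.sub (integrable_const _))
          (integrable_sub_mul x (f := fun ω => T (rewards ω) - N (rewards ω)) (by fun_prop)
            fun ω => (Nat.sub_le _ _).trans (hT.le _))
          fun ω => by
            simpa only [Set.indicator_apply, Set.mem_ofPred_eq] using
              le_sub_mul_natSub (hT.le _) (hNn _) ω.1 G x

theorem integrable_linear_sub_mul_max (ν : ℝ) (v : ℝ≥0) (a b c d : ℝ) :
    Integrable (fun x => a + (b - x) * c - d * max (x - b) 0) (gaussianReal ν v) := by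
  have hid : Integrable (fun x : ℝ => x) (gaussianReal ν v) :=
    (memLp_id_gaussianReal 1).integrable le_rfl
  exact ((integrable_const a).add (((integrable_const b).sub hid).mul_const c)).sub
    ((hid.sub (integrable_const b)).pos_part.const_mul d)

theorem integral_linear_sub_mul_max (ν : ℝ) (v : ℝ≥0) (a b c d : ℝ) :
    ∫ x, (a + (b - x) * c - d * max (x - b) 0) ∂(gaussianReal ν v) =
      a + (b - ν) * c - d * ∫ x, max (x - b) 0 ∂(gaussianReal ν v) := by
  have hid : Integrable (fun x : ℝ => x) (gaussianReal ν v) :=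
    (memLp_id_gaussianReal 1).integrable le_rfl
  have hlin : Integrable (fun x => (b - x) * c) (gaussianReal ν v) :=
    ((integrable_const b).sub hid).mul_const c
  have hadd : Integrable (fun x => a + (b - x) * c) (gaussianReal ν v) :=
    (integrable_const a).add hlin
  have hmax : Integrable (fun x => d * max (x - b) 0) (gaussianReal ν v) :=
    (hid.sub (integrable_const b)).pos_part.const_mul d
  rw [integral_sub hadd hmax, integral_add (integrable_const a) hlin, integral_const_mul,
    integral_mul_const, integral_sub (integrable_const b) hid]
  simp only [integral_const, probReal_univ, one_smul, integral_id_gaussianReal]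

namespace Strategy

variable (π : Strategy 2) (u : unitInterval)

theorem pulls_one_lt {r : Fin 2 → ℕ → ℝ} (hn : 1 ≤ n) (hu : π.act 0 u Fin.elim0 = 0) :
    pulls (π.tableHistory u r n) 1 < n := by
  have hmono := π.monotone_pulls_tableHistory u r 0 hn
  have hsum := pulls_zero_add_pulls_one (π.tableHistory u r n)
  have hone : pulls (π.tableHistory u r 1) 0 = 1 := by
    have hact : π.act 0 u (π.tableHistory u r 0) = 0 := hu
    simp [hact]
  simp only [hone] at hmono
  omega

theorem tableRegret_sub_tableRegret_exploreFirst (hT : IsObsRule n T)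
    (ω : Fin 2 → ℝ × (ℕ → ℝ)) :
    π.tableRegret n u ω - (π.exploreFirst T hT.measurable).tableRegret n u ω =
      ((ω 1).1 - (ω 0).1) * ((T (rewards (ω 1)) -
        pulls (π.tableHistory u ![rewards (ω 0), rewards (ω 1)] n) 1 : ℕ) : ℝ) := by
  have hr : (fun j => rewards (ω j)) = ![rewards (ω 0), rewards (ω 1)] :=
    funext (Fin.forall_fin_two.2 ⟨rfl, rfl⟩)
  have hpulls := π.pulls_exploreFirst_eq_add u hT.measurable hT.nonAnticipating
    ![rewards (ω 0), rewards (ω 1)] (hT.le _)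
  have hsum (ρ : Strategy 2) : (pulls (ρ.tableHistory u ![rewards (ω 0), rewards (ω 1)] n) 0 : ℝ) =
      n - pulls (ρ.tableHistory u ![rewards (ω 0), rewards (ω 1)] n) 1 :=
    eq_sub_of_add_eq (mod_cast pulls_zero_add_pulls_one _)
  simp only [tableRegret, Fin.sum_univ_two, hr, hsum, hpulls, Nat.cast_add]
  simp only [Matrix.cons_val_one, Matrix.cons_val_fin_one]
  ring

theorem integral_tableRegret_sub_tableRegret_exploreFirst (hT : IsObsRule n T) (ν : Fin 2 → ℝ)
    (v : Fin 2 → ℝ≥0) :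
    ∫ ω, (π.tableRegret n u ω - (π.exploreFirst T hT.measurable).tableRegret n u ω)
        ∂(Measure.pi fun i => armLaw (ν i) (v i)) =
      ∫ p, (p.2.1 - p.1.1) * ((T (rewards p.2) -
          pulls (π.tableHistory u ![rewards p.1, rewards p.2] n) 1 : ℕ) : ℝ)
        ∂(armLaw (ν 0) (v 0)).prod (armLaw (ν 1) (v 1)) := by
  simp only [π.tableRegret_sub_tableRegret_exploreFirst u hT]
  exact (measurePreserving_piFinTwo fun i => armLaw (ν i) (v i)).integral_comp'
    fun p : (ℝ × (ℕ → ℝ)) × (ℝ × (ℕ → ℝ)) => (p.2.1 - p.1.1) * ((T (rewards p.2) -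
      pulls (π.tableHistory u ![rewards p.1, rewards p.2] n) 1 : ℕ) : ℝ)

theorem integrable_sub_mul_pulls (hT : IsObsRule n T) (ν : Fin 2 → ℝ) (v : Fin 2 → ℝ≥0) :
    Integrable (fun p : (ℝ × (ℕ → ℝ)) × (ℝ × (ℕ → ℝ)) => (p.2.1 - p.1.1) * ((T (rewards p.2) -
      pulls (π.tableHistory u ![rewards p.1, rewards p.2] n) 1 : ℕ) : ℝ))
      ((armLaw (ν 0) (v 0)).prod (armLaw (ν 1) (v 1))) := by
  have hTm := hT.measurable
  have hr : Measurable fun p : (ℝ × (ℕ → ℝ)) × (ℝ × (ℕ → ℝ)) =>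
      (![rewards p.1, rewards p.2] : Fin 2 → ℕ → ℝ) :=
    measurable_pi_lambda _ (Fin.forall_fin_two.2
      ⟨measurable_rewards.comp measurable_fst, measurable_rewards.comp measurable_snd⟩)
  have hsub : Measurable fun p : (ℝ × (ℕ → ℝ)) × (ℝ × (ℕ → ℝ)) =>
      T (rewards p.2) - pulls (π.tableHistory u ![rewards p.1, rewards p.2] n) 1 := by
    fun_prop
  refine (((integrable_fst_armLaw _ _).comp_snd _).sub
    ((integrable_fst_armLaw _ _).comp_fst _)).mul_bdd (c := n)
    (measurable_from_top.comp hsub).aestronglyMeasurable (.of_forall fun p => ?_)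
  simpa only [Real.norm_natCast, Nat.cast_le] using (Nat.sub_le _ _).trans (hT.le _)

theorem le_integral_tableRegret_sub_tableRegret_exploreFirst (hT : IsObsRule n T)
    (hu : π.act 0 u Fin.elim0 = 0) (ν : Fin 2 → ℝ) (v : Fin 2 → ℝ≥0) :
    gain (ν 1) (v 1) (gittinsIndex (ν 1) (v 1) n) T +
        (gittinsIndex (ν 1) (v 1) n - ν 0) *
          (armLaw (ν 1) (v 1)).real {ω | T (rewards ω) = n} -
        (n - 1) * ∫ x, max (x - gittinsIndex (ν 1) (v 1) n) 0 ∂(gaussianReal (ν 0) (v 0)) ≤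
      ∫ ω, (π.tableRegret n u ω - (π.exploreFirst T hT.measurable).tableRegret n u ω)
        ∂(Measure.pi fun i => armLaw (ν i) (v i)) := by
  have hn : 1 ≤ n := (hT.one_le 0).trans (hT.le 0)
  set G := gittinsIndex (ν 1) (v 1) n
  set g := gain (ν 1) (v 1) G T
  set q := (armLaw (ν 1) (v 1)).real {ω | T (rewards ω) = n}
  have hint := π.integrable_sub_mul_pulls u hT ν v
  have hbound := integrable_linear_sub_mul_max (ν 0) (v 0) g G q (n - 1)
  calc g + (G - ν 0) * q - (n - 1) * ∫ x, max (x - G) 0 ∂(gaussianReal (ν 0) (v 0))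
      = ∫ ω, (g + (G - ω.1) * q - (n - 1) * max (ω.1 - G) 0) ∂(armLaw (ν 0) (v 0)) := by
        rw [← integral_linear_sub_mul_max, ← (hasLaw_fst_armLaw (ν 0) (v 0)).map_eq,
          integral_map (by fun_prop) (by fun_prop)]
    _ ≤ _ := by
        rw [π.integral_tableRegret_sub_tableRegret_exploreFirst u hT, integral_prod _ hint]
        exact integral_mono (hbound.comp_fst noise) hint.integral_prod_left fun ω =>
          hT.le_integral_sub_mul (π.nonAnticipating_pulls u (rewards ω) n) (by fun_prop)
            (fun y => π.pulls_one_lt u hn hu) ω.1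

end Strategy

end FirstRound

section GaussianTail

/-- The Chernoff bound, in terms of the mean excess over a level instead of a tail probability. -/
theorem integral_max_sub_le_exp_mul_mgf {Ω : Type*} [MeasurableSpace Ω] {P : Measure Ω}
    {X : Ω → ℝ} {t : ℝ} (ht : 0 < t) (hX : Integrable (fun ω => Real.exp (t * X ω)) P) (a : ℝ) :
    ∫ ω, max (X ω - a) 0 ∂P ≤ Real.exp (-(t * a)) / t * mgf X P t := by
  rw [mgf, ← integral_const_mul]
  refine integral_mono_of_nonneg (.of_forall fun ω => le_max_right _ _) (hX.const_mul _)
    (.of_forall fun ω => ?_)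
  change max (X ω - a) 0 ≤ Real.exp (-(t * a)) / t * Real.exp (t * X ω)
  rw [div_mul_eq_mul_div, ← Real.exp_add]
  refine max_le ?_ (by positivity)
  rw [le_div_iff₀ ht]
  linarith [Real.add_one_le_exp (-(t * a) + t * X ω)]

theorem integral_max_sub_gaussianReal_le {ν : ℝ} {v : ℝ≥0} {a L : ℝ} (hL : 0 < L) (ha : ν < a)
    (hv : v * L ≤ (a - ν) ^ 2) :
    ∫ x, max (x - a) 0 ∂(gaussianReal ν v) ≤ (a - ν) / L * Real.exp (-(L / 2)) := by
  have hΔ : 0 < a - ν := sub_pos.2 ha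
  set t := L / (a - ν)
  have ht : 0 < t := div_pos hL hΔ
  have htΔ : t * (a - ν) = L := div_mul_cancel₀ _ hΔ.ne'
  have hvt : v * t ^ 2 ≤ L := by
    rw [div_pow, ← mul_div_assoc, div_le_iff₀ (by positivity)]
    nlinarith
  calc ∫ x, max (x - a) 0 ∂(gaussianReal ν v)
      ≤ Real.exp (-(t * a)) / t * Real.exp (ν * t + v * t ^ 2 / 2) := by
        rw [← congrFun mgf_fun_id_gaussianReal t]
        exact integral_max_sub_le_exp_mul_mgf ht (integrable_exp_mul_gaussianReal t) a
    _ = (a - ν) / L * Real.exp (-L + v * t ^ 2 / 2) := by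
        have hinv : t⁻¹ = (a - ν) / L := inv_div _ _
        rw [div_mul_eq_mul_div, ← Real.exp_add, div_eq_inv_mul, hinv, ← htΔ]
        ring_nf
    _ ≤ (a - ν) / L * Real.exp (-(L / 2)) := by
        gcongr
        linarith

theorem exp_neg_mul_log_natCast_le {n k : ℕ} {c : ℝ} (hn : 1 ≤ n) (hc : k ≤ c) :
    Real.exp (-(c * Real.log n)) ≤ 1 / (n : ℝ) ^ k := by
  have hn0 : (0 : ℝ) < n := mod_cast hn
  rw [one_div, ← Real.exp_log (pow_pos hn0 k), ← Real.exp_neg, Real.exp_le_exp, Real.log_pow,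
    neg_le_neg_iff]
  exact mul_le_mul_of_nonneg_right hc (Real.log_natCast_nonneg n)

theorem exists_pred_mul_integral_max_sub_gaussianReal_lt {K : ℝ} (hK : 0 < K) :
    ∃ c : ℝ, 0 < c ∧ ∀ (n : ℕ) (ν : ℝ) (v : ℝ≥0) (a : ℝ), 1 ≤ n →
      ν + √(2 * c * v * Real.log n) < a →
        (n - 1) * ∫ x, max (x - a) 0 ∂(gaussianReal ν v) < (a - ν) * (K / n ^ 3) := by
  have hlog2 : 0 < Real.log 2 := Real.log_pos one_lt_two
  set c := 4 + 1 / (2 * K * Real.log 2)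
  have hc4 : 4 ≤ c := le_add_of_nonneg_right (by positivity)
  refine ⟨c, by linarith, fun n ν v a hn hlt => ?_⟩
  have hνa : ν < a := (le_add_of_nonneg_right (Real.sqrt_nonneg _)).trans_lt hlt
  have hΔ : 0 < a - ν := sub_pos.2 hνa
  rcases hn.eq_or_lt with rfl | hn2
  · simpa using mul_pos hΔ hK
  have hn2' : (2 : ℝ) ≤ n := mod_cast hn2
  have hlogn : Real.log 2 ≤ Real.log n := Real.log_le_log two_pos hn2'
  have hlog : 0 < Real.log n := hlog2.trans_le hlogn
  have hv : v * (2 * c * Real.log n) ≤ (a - ν) ^ 2 := by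
    have := (Real.sqrt_le_left hΔ.le).1 (lt_sub_iff_add_lt'.2 hlt).le
    linarith
  have hLK : 1 ≤ K * (2 * c * Real.log n) := by
    calc 1 = K * (2 * (1 / (2 * K * Real.log 2)) * Real.log 2) := by field_simp
      _ ≤ K * (2 * c * Real.log n) := by
        gcongr
        linarith
  have hexp : Real.exp (-(2 * c * Real.log n / 2)) ≤ 1 / (n : ℝ) ^ 4 := by
    rw [mul_assoc, mul_div_cancel_left₀ _ two_ne_zero]
    exact exp_neg_mul_log_natCast_le hn (mod_cast hc4)
  calc (n - 1) * ∫ x, max (x - a) 0 ∂(gaussianReal ν v)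
      ≤ (n - 1) * ((a - ν) / (2 * c * Real.log n) * Real.exp (-(2 * c * Real.log n / 2))) :=
        mul_le_mul_of_nonneg_left (integral_max_sub_gaussianReal_le (by positivity) hνa hv)
          (by linarith)
    _ ≤ (n - 1) * ((a - ν) * K * (1 / (n : ℝ) ^ 4)) := by
        gcongr
        · linarith
        · rw [div_le_iff₀ (by positivity), mul_assoc]
          exact le_mul_of_one_le_right hΔ.le hLK
    _ < n * ((a - ν) * K * (1 / (n : ℝ) ^ 4)) :=
        mul_lt_mul_of_pos_right (by linarith) (by positivity)
    _ = (a - ν) * (K / n ^ 3) := by field_simp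

end GaussianTail

end Bandit

end

theorem theorem4 :
    ∃ c : ℝ, 0 < c ∧
      ∀ (n : ℕ) (ν : Fin 2 → ℝ) (v : Fin 2 → ℝ≥0) (π : Bandit.Strategy 2),
        1 ≤ n →
        π.IsBayesOptimal n (Bandit.gaussianPrior ν v) →
        0 < π.probFirst 0 →
        Bandit.gittinsIndex (ν 1) (v 1) n ≤ ν 0 + Real.sqrt (2 * c * (v 0 : ℝ) * Real.log n) := by
  have hK : 0 < min (Bandit.gaussianPosPart ^ 2 / 4) 1 :=
    lt_min (div_pos (pow_pos Bandit.gaussianPosPart_pos 2) four_pos) one_pos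
  obtain ⟨c, hc, htail⟩ := Bandit.exists_pred_mul_integral_max_sub_gaussianReal_lt hK
  refine ⟨c, hc, fun n ν v π hn hopt hfirst => ?_⟩
  by_contra! hlt
  have hΔ := (le_add_of_nonneg_right (Real.sqrt_nonneg _)).trans_lt hlt
  have htail := htail n (ν 0) (v 0) _ hn hlt
  obtain ⟨T, hT, hgain, hprob⟩ :=
    Bandit.exists_isObsRule_le_prob_horizon (ν 1) (v 1) hn (sub_pos.2 htail)
  obtain ⟨u, hu, hregret⟩ := ((frequently_ae_mem_iff.2 hfirst.ne').and_eventually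
    (hopt.ae_integral_tableRegret_le (π.exploreFirst T hT.measurable))).exists
  have hlower := π.le_integral_tableRegret_sub_tableRegret_exploreFirst u hT hu ν v
  linarith [mul_le_mul_of_nonneg_left hprob (sub_pos.2 hΔ).le]
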